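/- Let $m=(m_0,m_1,\dots)$ be a bounded sequence of integers $m_k\ge 2$, let $G_m=\prod_{k\ge 0}\mathbb Z/m_k$ with its normalized Haar measure $\mu$ (the product of the uniform measures), and put $M_0=1$, $M_{k+1}=m_kM_k$. Every $n\in\mathbb N$ has a unique expansion $n=\sum_{j\ge0}n_jM_j$ with $0\le n_j<m_j$; for $n\ge1$ put $\langle n\rangle=\min\{j:n_j\ne0\}$, $|n|=\max\{j:n_j\neq 0\}$ and $\rho(n)=|n|-\langle n\rangle$. Let $\psi_n(x)=\prod_{k}\exp(2\pi i\,x_k n_k/m_k)$ be the Vilenkin functions and let $\mathcal F_n$ be the $\sigma$-algebra generated by the sets $I_n(x)=\{y: y_j=x_j,\ j<n\}$, $x\in G_m$. For a (complex-valued) martingale $f=(f^{(n)})_{n\in\mathbb N}$ with respect to $(\mathcal F_n)$ put $\widehat f(i)=\lim_{k\to\infty}\int f^{(k)}\overline{\psi_i}\,d\mu$, $S_kf=\sum_{i<k}\widehat f(i)\psi_i$ and $\sigma_nf=\frac1n\sum_{k=1}^nS_kf$ ($n\ge1$). For $0<p<\infty$ let $\|f\|_{H_p}=\big(\int\sup_n|f^{(n)}|^p\,d\mu\big)^{1/p}$,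 and let $H_p$ be the set of martingales for which this is finite; an integrable function $F$ is identified with the martingale $(E[F\mid\mathcal F_n])_n$. Finally $\|F\|_{\text{weak-}L_p}=\sup_{t>0}t\,\mu(|F|>t)^{1/p}$. a) Let $0<p<1/2$. There is a constant $c_p$, depending only on $p$ and on an upper bound for the numbers $m_k$, such that for all $f\in H_p$ and all $n\ge1$ (hence along every sequence $(n_k)$ of positive integers) $$\|\sigma_nf\|_{H_p}\le c_p\,\frac{M_{|n|}^{1/p-2}}{M_{\langle n\rangle}^{1/p-2}}\,\|f\|_{H_p}.$$ b) (Sharpness) Let $0<p<1/2$, let $(n_k)$ be a sequence of positive integers with $\sup_k\langle n_k+1\rangle<\infty$ (this holds for instance if $\langle n_k\rangle\ge1$ for all $k$, or if $n_k=M_k+1$), and let $\Phi:\mathbb N\to(0,\infty)$ be nondecreasing, such that $$\sup_k\rho(n_k)=\infty,\qquad \limsup_{k\to\infty}\frac{M_{|n_k|}^{1/p-2}}{M_{\langle n_k\rangle}^{1/p-2}\,\Phi(n_k)}=\infty.$$ Then there is a martingale $f\in H_p$ such that $$\sup_{k}\Big\|\frac{\sigma_{n_k}f}{\Phi(n_k)}\Big\|_{\text{weak-}L_p}=\infty.$$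 -/

import Mathlib

open MeasureTheory ProbabilityTheory Filter Topology
open scoped ENNReal NNReal ComplexConjugate

namespace Vilenkin

/-- A generating sequence `m = (m₀, m₁, …)` of integers not less than `2`. -/
structure GenSeq where
  m : ℕ → ℕ
  two_le : ∀ k, 2 ≤ m k

instance instNeZeroGenSeq (g : GenSeq) (k : ℕ) : NeZero (g.m k) :=
  ⟨by have := g.two_le k; omega⟩

/-- The Vilenkin group `G_m`, the complete direct product of the groups `ℤ / m_k`, with the
product group structure, topology and `σ`-algebra. -/
abbrev G (g : GenSeq) : Type := ∀ k : ℕ, ZMod (g.m k)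

/-- The normalized Haar measure: the product of the uniform probability measures on `ℤ / m_k`. -/
noncomputable def haar (g : GenSeq) : Measure (G g) :=
  Measure.infinitePi fun k => uniformOn (Set.univ : Set (ZMod (g.m k)))

instance instIsProbabilityMeasureHaar (g : GenSeq) : IsProbabilityMeasure (haar g) := by
  unfold haar; infer_instance

/-- The generalized number system: `M_0 = 1`, `M_{k+1} = m_k M_k`. -/
def M (g : GenSeq) (k : ℕ) : ℕ := ∏ j ∈ Finset.range k, g.m j

/-- The digit `n_k` in the expansion `n = ∑ n_k M_k`, `0 ≤ n_k < m_k`. -/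
def digit (g : GenSeq) (n k : ℕ) : ℕ := n / M g k % g.m k

/-- `⟨n⟩ = min {j : n_j ≠ 0}` (for `n ≥ 1`). -/
noncomputable def lo (g : GenSeq) (n : ℕ) : ℕ := sInf {j | digit g n j ≠ 0}

/-- `|n| = max {j : n_j ≠ 0}` (for `n ≥ 1`). -/
noncomputable def hi (g : GenSeq) (n : ℕ) : ℕ := sSup {j | digit g n j ≠ 0}

/-- `ρ(n) = |n| - ⟨n⟩` (for `n ≥ 1`, when `⟨n⟩ ≤ |n|`). -/
noncomputable def rho (g : GenSeq) (n : ℕ) : ℕ := hi g n - lo g n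

/-- The generalized Rademacher function `r_k(x) = exp(2πi x_k / m_k)`. -/
noncomputable def rademacher (g : GenSeq) (k : ℕ) (x : G g) : ℂ :=
  Complex.exp (2 * Real.pi * Complex.I * ((x k).val : ℂ) / (g.m k : ℂ))

/-- The Vilenkin function `ψ_n = ∏_k r_k ^ n_k`. Since `M_k ≥ 2 ^ k > n` for `k ≥ n`, all digits
`n_k` with `k ≥ n` vanish, so that the product over `k < n` is the full product. -/
noncomputable def psi (g : GenSeq) (n : ℕ) (x : G g) : ℂ :=
  ∏ k ∈ Finset.range n, rademacher g k x ^ digit g n k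

/-- The interval `I_n(x)` of all `y` with `y_0 = x_0, …, y_{n-1} = x_{n-1}`. -/
def interval (g : GenSeq) (n : ℕ) (x : G g) : Set (G g) := {y | ∀ k < n, y k = x k}

theorem measurableSet_interval (g : GenSeq) (n : ℕ) (x : G g) :
    MeasurableSet (interval g n x) := by
  have h : interval g n x = ⋂ k : ℕ, ⋂ _ : k < n, (fun y : G g => y k) ⁻¹' {x k} := by
    ext y; simp [interval]
  rw [h]
  exact MeasurableSet.iInter fun k => MeasurableSet.iInter fun _ =>
    measurable_pi_apply k (MeasurableSet.of_discrete)

theorem finite_range_interval (g : GenSeq) (n : ℕ) :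
    (Set.range (interval g n)).Finite := by
  have h : Set.range (interval g n) ⊆
      Set.range (fun z : (∀ k : Fin n, ZMod (g.m k)) =>
        {y : G g | ∀ k : Fin n, y k = z k}) := by
    rintro _ ⟨x, rfl⟩
    refine ⟨fun k => x k, ?_⟩
    ext y
    exact ⟨fun hy k hk => hy ⟨k, hk⟩, fun hy k => hy k k.2⟩
  exact (Set.finite_range _).subset h

/-- The filtration `F_n`, the `σ`-algebra generated by the intervals `I_n(x)`, `x ∈ G_m`. -/
def filt (g : GenSeq) : Filtration ℕ (inferInstance : MeasurableSpace (G g)) where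
  seq n := MeasurableSpace.generateFrom (Set.range (interval g n))
  mono' := by
    intro n k hnk
    refine MeasurableSpace.generateFrom_le ?_
    rintro _ ⟨x, rfl⟩
    have h : interval g n x = ⋃₀ (interval g k '' interval g n x) := by
      ext y
      constructor
      · intro hy
        exact ⟨_, ⟨y, hy, rfl⟩, fun _ _ => rfl⟩
      · rintro ⟨_, ⟨z, hz, rfl⟩, hy⟩ j hj
        exact (hy j (hj.trans_le hnk)).trans (hz j hj)
    rw [h]
    refine Set.Finite.measurableSet_sUnion
      ((finite_range_interval g k).subset (Set.image_subset_range _ _)) ?_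
    rintro _ ⟨z, -, rfl⟩
    exact MeasurableSpace.measurableSet_generateFrom ⟨z, rfl⟩
  le' := by
    intro n
    refine MeasurableSpace.generateFrom_le ?_
    rintro _ ⟨x, rfl⟩
    exact measurableSet_interval g n x

/-- The Vilenkin–Fourier coefficients of a martingale `f = (f^(k))`:
the limit of `∫ f^(k) ψ̄_i dμ` as `k → ∞` (an eventually constant sequence). -/
noncomputable def coeff (g : GenSeq) (f : ℕ → G g → ℂ) (i : ℕ) : ℂ :=
  limUnder atTop fun k => ∫ x, f k x * conj (psi g i x) ∂(haar g)

/-- The partial sums `S_n f = ∑_{k<n} f̂(k) ψ_k`. -/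
noncomputable def partialSum (g : GenSeq) (f : ℕ → G g → ℂ) (n : ℕ) (x : G g) : ℂ :=
  ∑ k ∈ Finset.range n, coeff g f k * psi g k x

/-- The Fejér means `σ_n f = (1/n) ∑_{k=1}^n S_k f`. -/
noncomputable def fejer (g : GenSeq) (f : ℕ → G g → ℂ) (n : ℕ) (x : G g) : ℂ :=
  (1 / (n : ℂ)) * ∑ k ∈ Finset.Icc 1 n, partialSum g f k x

/-- The maximal function `f^* = sup_n |f^(n)|`. -/
noncomputable def maximal (g : GenSeq) (f : ℕ → G g → ℂ) (x : G g) : ℝ≥0∞ :=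
  ⨆ n, ‖f n x‖ₑ

/-- The Hardy quasi-norm `‖f‖_{H_p} = ‖f^*‖_p`, with values in `[0, ∞]`. -/
noncomputable def hardyNorm (g : GenSeq) (p : ℝ) (f : ℕ → G g → ℂ) : ℝ≥0∞ :=
  (∫⁻ x, maximal g f x ^ p ∂(haar g)) ^ (1 / p)

/-- `f` is a martingale that belongs to the martingale Hardy space `H_p`. -/
def MemHardy (g : GenSeq) (p : ℝ) (f : ℕ → G g → ℂ) : Prop :=
  Martingale f (filt g) (haar g) ∧ hardyNorm g p f < ∞

/-- The regular martingale `(E_n F)` generated by an integrable function `F`. -/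
noncomputable def regular (g : GenSeq) (F : G g → ℂ) (n : ℕ) : G g → ℂ :=
  (haar g)[F | filt g n]

/-- The weak-`L_p` quasi-norm `sup_{t>0} t μ(|F| > t)^{1/p}`, with values in `[0, ∞]`. -/
noncomputable def weakNorm (g : GenSeq) (p : ℝ) (F : G g → ℂ) : ℝ≥0∞ :=
  ⨆ (t : ℝ≥0) (_ : 0 < t), (t : ℝ≥0∞) * haar g {x | (t : ℝ≥0∞) < ‖F x‖ₑ} ^ (1 / p)

/-- The rate `M_{|n|}^{1/p-2} / M_{⟨n⟩}^{1/p-2}`. -/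
noncomputable def rate (g : GenSeq) (p : ℝ) (n : ℕ) : ℝ :=
  (M g (hi g n) : ℝ) ^ (1 / p - 2) / (M g (lo g n) : ℝ) ^ (1 / p - 2)

end Vilenkin

namespace Vilenkin

/-! ### The generalized number system -/

/-! A martingale satisfies `f k = poly g (coeff g f) (M g k)` pointwise (`martingale_eq_poly`), and
conditioning a Vilenkin polynomial on `filt g k` cuts it off at degree `M g k` (`condExp_poly`).
Both halves thus become statements about the polynomials `∑ (n - i) c_i ψ_i`.

Upper bound. No atoms are needed; only translation invariance and the `p`-subadditivity of `powInt`
are used. Selecting the indices with a prescribed `l`-th digit is an average of `m_l` translates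
with unimodular weights, so it costs a factor `m_l^(1-p)` (`powInt_slice_le`). Writing `i = ∑ i_l
M_l`, the multiplier `i ↦ i` on degree `< M_K` costs `M_K^p` up to a constant
(`powInt_index_mul_le`). For general `n`, the leading digits are peeled off one at a time
(`powInt_fejer_sum_le`): a nonzero digit `n_j` contributes `M_j^(2p-1)`, against a total factor
`M_{|n|+1}^(1-p)`. As `2p - 1 < 0`, the lowest nonzero digit dominates, and division by `n^p` leaves
the `p`-th power of the rate. The conditional expectations at levels `k ≤ |n|` are handled by `n - i
= (n - M_k) + (M_k - i)`.

Sharpness. The martingale has constant coefficients `γ_N M_N^(1/p-1)` on the blocks `M_N ≤ i <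
M_{N+1}`; its `H_p` quasi-norm is controlled by `∑ γ_N^p` (`lintegral_maximal_blockCoeff_le`). On an
interval of measure comparable to `1 / M_⟨n⟩`, `n` times the Fejér kernel has modulus at least a
constant times `M_⟨n⟩^2` (`exists_interval_fejerSum_ge`), and the kernels of all higher levels
vanish, so the top block alone makes `σ_n f` large there. With `q = rate / Φ` and `γ = q^(-1/2)`
along a lacunary subsequence, the `p`-sum converges while the weak quasi-norms are at least a
constant times `q^(1/2)` (`weakNorm_fejer_ge`). The bound on `⟨n + 1⟩` is needed when `⟨n⟩ = 0`. -/

theorem M_succ (g : GenSeq) (k : ℕ) : M g (k + 1) = g.m k * M g k := by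
  rw [M, Finset.prod_range_succ, mul_comm]; rfl

theorem M_zero (g : GenSeq) : M g 0 = 1 := rfl

theorem m_pos (g : GenSeq) (k : ℕ) : 0 < g.m k := by have := g.two_le k; omega

theorem M_pos (g : GenSeq) (k : ℕ) : 0 < M g k :=
  Finset.prod_pos fun j _ => m_pos g j

theorem M_dvd_M (g : GenSeq) {j k : ℕ} (h : j ≤ k) : M g j ∣ M g k :=
  Finset.prod_dvd_prod_of_subset _ _ _ (Finset.range_mono h)

theorem M_mono (g : GenSeq) : Monotone (M g) := fun _ k h =>
  Nat.le_of_dvd (M_pos g k) (M_dvd_M g h)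

theorem two_mul_M_le (g : GenSeq) (k : ℕ) : 2 * M g k ≤ M g (k + 1) := by
  rw [M_succ]; exact Nat.mul_le_mul_right _ (g.two_le k)

theorem M_strictMono (g : GenSeq) : StrictMono (M g) :=
  strictMono_nat_of_lt_succ fun k => by
    have := two_mul_M_le g k; have := M_pos g k; omega

theorem two_pow_mul_M_le (g : GenSeq) (j d : ℕ) : 2 ^ d * M g j ≤ M g (j + d) := by
  induction d with
  | zero => simp
  | succ d ih =>
    have := two_mul_M_le g (j + d)
    rw [pow_succ, ← add_assoc]
    calc 2 ^ d * 2 * M g j = 2 * (2 ^ d * M g j) := by ring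
      _ ≤ _ := by omega

theorem lt_M_self (g : GenSeq) (k : ℕ) : k < M g k := by
  have h := two_pow_mul_M_le g 0 k
  rw [M_zero, zero_add, mul_one] at h
  exact Nat.lt_two_pow_self.trans_le h

theorem M_add_le (g : GenSeq) {L : ℕ} (hL : ∀ k, g.m k ≤ L) (j d : ℕ) :
    M g (j + d) ≤ L ^ d * M g j := by
  induction d with
  | zero => simp
  | succ d ih =>
    rw [← add_assoc, M_succ, pow_succ]
    calc g.m (j + d) * M g (j + d) ≤ L * (L ^ d * M g j) := Nat.mul_le_mul (hL _) ih
      _ = _ := by ring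

theorem digit_lt (g : GenSeq) (n k : ℕ) : digit g n k < g.m k := Nat.mod_lt _ (m_pos g k)

theorem digit_eq_zero_of_lt {g : GenSeq} {n k : ℕ} (h : n < M g k) : digit g n k = 0 := by
  rw [digit, Nat.div_eq_of_lt h, Nat.zero_mod]

theorem digit_mul_add {g : GenSeq} {K t i : ℕ} (ht : t < g.m K) (hi : i < M g K) :
    digit g (t * M g K + i) K = t := by
  rw [digit, add_comm, Nat.add_mul_div_right _ _ (M_pos g K), Nat.div_eq_of_lt hi, zero_add,
    Nat.mod_eq_of_lt ht]

theorem digit_mul_add_of_lt (g : GenSeq) {K k : ℕ} (t i : ℕ) (hk : k < K) :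
    digit g (t * M g K + i) k = digit g i k := by
  obtain ⟨d, hd⟩ := M_dvd_M g (Nat.succ_le_of_lt hk)
  have : t * M g K + i = i + M g k * (g.m k * (t * d)) := by
    rw [hd, M_succ]; ring
  rw [digit, this, Nat.add_mul_div_left _ _ (M_pos g k), Nat.add_mul_mod_self_left]; rfl

theorem digit_mod (g : GenSeq) {K k : ℕ} (n : ℕ) (hk : k < K) :
    digit g (n % M g K) k = digit g n k := by
  conv_rhs => rw [← Nat.div_add_mod n (M g K), mul_comm]
  rw [digit_mul_add_of_lt g _ _ hk]

theorem mul_add_lt_M_succ {g : GenSeq} {K t i : ℕ} (ht : t < g.m K) (hi : i < M g K) :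
    t * M g K + i < M g (K + 1) := by
  rw [M_succ]
  calc t * M g K + i < (t + 1) * M g K := by rw [add_mul]; omega
    _ ≤ _ := Nat.mul_le_mul_right _ ht

theorem sum_digit_mul_M (g : GenSeq) (K : ℕ) {i : ℕ} (hi : i < M g K) :
    ∑ l ∈ Finset.range K, digit g i l * M g l = i := by
  induction K generalizing i with
  | zero => rw [M_zero] at hi; simp; omega
  | succ K ih =>
    rw [Finset.sum_range_succ]
    have h1 := ih (Nat.mod_lt i (M_pos g K))
    have h2 : ∑ l ∈ Finset.range K, digit g (i % M g K) l * M g l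
        = ∑ l ∈ Finset.range K, digit g i l * M g l :=
      Finset.sum_congr rfl fun l hl => by rw [digit_mod g i (Finset.mem_range.1 hl)]
    have h3 : digit g i K = i / M g K := by
      rw [digit, Nat.mod_eq_of_lt]
      rw [Nat.div_lt_iff_lt_mul (M_pos g K), ← M_succ]; exact hi
    rw [← h2, h1, h3, mul_comm, add_comm, Nat.div_add_mod]

theorem exists_digit_ne {g : GenSeq} {K i j : ℕ} (hi : i < M g K) (hj : j < M g K) (h : i ≠ j) :
    ∃ l < K, digit g i l ≠ digit g j l := by
  by_contra! hc
  apply h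
  rw [← sum_digit_mul_M g K hi, ← sum_digit_mul_M g K hj]
  exact Finset.sum_congr rfl fun l hl => by rw [hc l (Finset.mem_range.1 hl)]

theorem sum_range_mul_add {A : Type*} [AddCommMonoid A] (f : ℕ → A) (a N n : ℕ) :
    ∑ i ∈ Finset.range (a * N + n), f i
      = ∑ t ∈ Finset.range a, ∑ i ∈ Finset.range N, f (t * N + i)
        + ∑ i ∈ Finset.range n, f (a * N + i) := by
  rw [Finset.sum_range_add]
  congr 1
  induction a with
  | zero => simp
  | succ a ih => rw [add_mul, one_mul, Finset.sum_range_add, ih, Finset.sum_range_succ]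

theorem sum_range_M_succ {A : Type*} [AddCommMonoid A] (g : GenSeq) (f : ℕ → A) (K : ℕ) :
    ∑ i ∈ Finset.range (M g (K + 1)), f i
      = ∑ t ∈ Finset.range (g.m K), ∑ i ∈ Finset.range (M g K), f (t * M g K + i) := by
  rw [M_succ, ← add_zero (g.m K * M g K), sum_range_mul_add]; simp

/-! ### Lowest and highest digits -/

theorem digits_nonempty (g : GenSeq) {n : ℕ} (hn : 1 ≤ n) : {j | digit g n j ≠ 0}.Nonempty := by
  obtain ⟨l, -, hl⟩ := exists_digit_ne (lt_M_self g n) (M_pos g n) (by omega : n ≠ 0)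
  refine ⟨l, fun h => hl ?_⟩
  rw [h, digit_eq_zero_of_lt (M_pos g l)]

theorem digits_bddAbove (g : GenSeq) (n : ℕ) : BddAbove {j | digit g n j ≠ 0} := by
  refine ⟨n, fun j hj => ?_⟩
  by_contra! hc
  exact hj (digit_eq_zero_of_lt (hc.trans (lt_M_self g j)))

theorem digit_lo_ne_zero (g : GenSeq) {n : ℕ} (hn : 1 ≤ n) : digit g n (lo g n) ≠ 0 :=
  Nat.sInf_mem (digits_nonempty g hn)

theorem lo_le {g : GenSeq} {n j : ℕ} (h : digit g n j ≠ 0) : lo g n ≤ j := Nat.sInf_le h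

theorem digit_hi_ne_zero (g : GenSeq) {n : ℕ} (hn : 1 ≤ n) : digit g n (hi g n) ≠ 0 :=
  Nat.sSup_mem (digits_nonempty g hn) (digits_bddAbove g n)

theorem le_hi {g : GenSeq} {n j : ℕ} (h : digit g n j ≠ 0) : j ≤ hi g n :=
  le_csSup (digits_bddAbove g n) h

theorem lo_le_hi (g : GenSeq) {n : ℕ} (hn : 1 ≤ n) : lo g n ≤ hi g n := lo_le (digit_hi_ne_zero g hn)

theorem M_hi_le (g : GenSeq) {n : ℕ} (hn : 1 ≤ n) : M g (hi g n) ≤ n := by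
  by_contra! hc
  exact digit_hi_ne_zero g hn (digit_eq_zero_of_lt hc)

theorem mod_M_eq_zero {g : GenSeq} {n K : ℕ} (h : ∀ j < K, digit g n j = 0) : n % M g K = 0 := by
  rw [← sum_digit_mul_M g K (Nat.mod_lt n (M_pos g K))]
  refine Finset.sum_eq_zero fun l hl => ?_
  rw [digit_mod g n (Finset.mem_range.1 hl), h l (Finset.mem_range.1 hl), zero_mul]

theorem mod_M_lo (g : GenSeq) (n : ℕ) : n % M g (lo g n) = 0 :=
  mod_M_eq_zero fun j hj => by
    by_contra hc
    exact absurd (lo_le hc) (not_le.2 hj)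

theorem lt_M_of_digit_eq_zero {g : GenSeq} {n K : ℕ} (h : ∀ j, K ≤ j → digit g n j = 0) :
    n < M g K := by
  have h1 := sum_digit_mul_M g (K + n) ((lt_M_self g n).trans_le (M_mono g (by omega : n ≤ K + n)))
  have h2 := sum_digit_mul_M g K (Nat.mod_lt n (M_pos g K))
  rw [Finset.sum_range_add] at h1
  have h3 : ∑ x ∈ Finset.range n, digit g n (K + x) * M g (K + x) = 0 :=
    Finset.sum_eq_zero fun x _ => by rw [h _ (by omega), zero_mul]
  have h4 : ∑ l ∈ Finset.range K, digit g (n % M g K) l * M g l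
        = ∑ l ∈ Finset.range K, digit g n l * M g l :=
      Finset.sum_congr rfl fun l hl => by rw [digit_mod g n (Finset.mem_range.1 hl)]
  have h5 : n = n % M g K := by omega
  rw [h5]; exact Nat.mod_lt n (M_pos g K)

theorem lt_M_hi_succ (g : GenSeq) (n : ℕ) : n < M g (hi g n + 1) :=
  lt_M_of_digit_eq_zero fun j hj => by
    by_contra hc
    have := le_hi hc; omega

theorem hi_eq {g : GenSeq} {n N : ℕ} (h1 : M g N ≤ n) (h2 : n < M g (N + 1)) : hi g n = N := by
  have hn : 1 ≤ n := (M_pos g N).trans_le h1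
  have h3 := M_hi_le g hn
  have h4 := lt_M_hi_succ g n
  have h5 : hi g n < N + 1 := (M_strictMono g).lt_iff_lt.1 (h3.trans_lt h2)
  have h6 : N < hi g n + 1 := (M_strictMono g).lt_iff_lt.1 (h1.trans_lt h4)
  omega

/-! ### Vilenkin functions -/

theorem rademacher_eq (g : GenSeq) (k : ℕ) (x : G g) :
    rademacher g k x = ZMod.stdAddChar (x k) := by
  rw [ZMod.stdAddChar_apply, ZMod.toCircle_apply]; rfl

theorem rademacher_add (g : GenSeq) (k : ℕ) (x y : G g) :
    rademacher g k (x + y) = rademacher g k x * rademacher g k y := by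
  simp only [rademacher_eq, Pi.add_apply, AddChar.map_add_eq_mul]

theorem norm_rademacher (g : GenSeq) (k : ℕ) (x : G g) : ‖rademacher g k x‖ = 1 := by
  rw [rademacher_eq, ZMod.stdAddChar_apply]; exact Circle.norm_coe _

theorem psi_eq_prod {g : GenSeq} {n K : ℕ} (h : n < M g K) (x : G g) :
    psi g n x = ∏ k ∈ Finset.range K, rademacher g k x ^ digit g n k := by
  have key : ∀ A B : ℕ, n < M g A →
      ∏ k ∈ Finset.range (A + B), rademacher g k x ^ digit g n k
        = ∏ k ∈ Finset.range A, rademacher g k x ^ digit g n k := by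
    intro A B hA
    rw [Finset.prod_range_add, Finset.prod_eq_one (s := Finset.range B), mul_one]
    intro j _
    rw [digit_eq_zero_of_lt (hA.trans_le (M_mono g (by omega))), pow_zero]
  rw [psi, ← key n K (lt_M_self g n), ← key K n h, add_comm]

theorem psi_mul_add {g : GenSeq} {K t i : ℕ} (ht : t < g.m K) (hi : i < M g K) (x : G g) :
    psi g (t * M g K + i) x = rademacher g K x ^ t * psi g i x := by
  rw [psi_eq_prod (mul_add_lt_M_succ ht hi), psi_eq_prod hi, Finset.prod_range_succ,
    digit_mul_add ht hi, mul_comm]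
  congr 1
  exact Finset.prod_congr rfl fun k hk => by
    rw [digit_mul_add_of_lt g _ _ (Finset.mem_range.1 hk)]

theorem norm_psi (g : GenSeq) (n : ℕ) (x : G g) : ‖psi g n x‖ = 1 := by
  rw [psi, norm_prod]
  exact Finset.prod_eq_one fun k _ => by rw [norm_pow, norm_rademacher, one_pow]

theorem psi_add (g : GenSeq) (n : ℕ) (x y : G g) : psi g n (x + y) = psi g n x * psi g n y := by
  simp only [psi, rademacher_add, mul_pow, Finset.prod_mul_distrib]

theorem psi_zero (g : GenSeq) (x : G g) : psi g 0 x = 1 := by simp [psi]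

theorem psi_congr {g : GenSeq} {n K : ℕ} (h : n < M g K) {x y : G g} (hxy : ∀ k < K, y k = x k) :
    psi g n y = psi g n x := by
  rw [psi_eq_prod h, psi_eq_prod h]
  exact Finset.prod_congr rfl fun k hk => by
    rw [rademacher_eq, rademacher_eq, hxy k (Finset.mem_range.1 hk)]

theorem psi_single (g : GenSeq) (n l : ℕ) (s : ZMod (g.m l)) :
    psi g n (Pi.single l s) = ZMod.stdAddChar s ^ digit g n l := by
  rw [psi_eq_prod ((lt_M_self g n).trans_le (M_mono g (by omega : n ≤ n + l + 1))),
    Finset.prod_eq_single l]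
  · rw [rademacher_eq, Pi.single_eq_same]
  · intro k _ hk
    rw [rademacher_eq, Pi.single_eq_of_ne hk, AddChar.map_zero_eq_one, one_pow]
  · intro h; simp at h

theorem measurable_rademacher (g : GenSeq) (k : ℕ) : Measurable (rademacher g k) := by
  have : rademacher g k = (fun z : ZMod (g.m k) => (ZMod.stdAddChar z : ℂ)) ∘ fun x => x k := by
    ext x; exact rademacher_eq g k x
  rw [this]
  exact (measurable_of_countable _).comp (measurable_pi_apply k)

theorem measurable_psi (g : GenSeq) (n : ℕ) : Measurable (psi g n) := by
  unfold psi
  exact Finset.measurable_prod _ fun k _ => (measurable_rademacher g k).pow_const _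

theorem stdAddChar_pow_ne {N : ℕ} [NeZero N] {a b : ℕ} (ha : a < N) (hb : b < N) (h : a ≠ b) :
    (ZMod.stdAddChar (1 : ZMod N) : ℂ) ^ a ≠ ZMod.stdAddChar (1 : ZMod N) ^ b := by
  intro hc
  rw [← AddChar.map_nsmul_eq_pow, ← AddChar.map_nsmul_eq_pow] at hc
  have := ZMod.injective_stdAddChar hc
  simp only [nsmul_eq_mul, mul_one] at this
  rw [ZMod.natCast_eq_natCast_iff', Nat.mod_eq_of_lt ha, Nat.mod_eq_of_lt hb] at this
  exact h this

theorem sum_stdAddChar_pow_mul {N : ℕ} [NeZero N] {a b : ℕ} (ha : a < N) (hb : b < N) :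
    ∑ s : ZMod N, (ZMod.stdAddChar s : ℂ) ^ a * conj (ZMod.stdAddChar s : ℂ) ^ b
      = if a = b then (N : ℂ) else 0 := by
  have h1 : ∀ s : ZMod N, (ZMod.stdAddChar s : ℂ) ^ a * conj (ZMod.stdAddChar s : ℂ) ^ b
      = ZMod.stdAddChar (s * ((a : ZMod N) - (b : ZMod N))) := by
    intro s
    rw [← map_pow (starRingEnd ℂ), ← AddChar.map_nsmul_eq_pow, ← AddChar.map_nsmul_eq_pow,
      ← AddChar.map_neg_eq_conj, ← AddChar.map_add_eq_mul, nsmul_eq_mul, nsmul_eq_mul]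
    congr 1; ring
  have h2 : ((a : ZMod N) - (b : ZMod N) = 0) ↔ a = b := by
    rw [sub_eq_zero, ZMod.natCast_eq_natCast_iff', Nat.mod_eq_of_lt ha, Nat.mod_eq_of_lt hb]
  simp_rw [h1]
  rw [AddChar.sum_mulShift _ (ZMod.isPrimitive_stdAddChar N), ZMod.card]
  by_cases h : a = b
  · rw [if_pos (h2.2 h), if_pos h]
  · rw [if_neg (fun h' => h (h2.1 h')), if_neg h, Nat.cast_zero]

/-! ### The Haar measure -/

theorem map_add_uniformOn_univ (N : ℕ) [NeZero N] (c : ZMod N) :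
    (uniformOn (Set.univ : Set (ZMod N))).map (fun z => c + z) = uniformOn Set.univ := by
  ext s hs
  rw [Measure.map_apply (measurable_of_countable _) hs, uniformOn_univ, uniformOn_univ,
    Measure.count_apply (MeasurableSet.of_discrete), Measure.count_apply hs,
    Set.encard_preimage_of_bijective (AddGroup.addLeft_bijective c)]

instance instIsAddLeftInvariantHaar (g : GenSeq) : (haar g).IsAddLeftInvariant where
  map_add_left_eq_self c := by
    unfold haar
    have h : (fun x : G g => c + x) = fun x k => c k + x k := rfl
    rw [h, Measure.infinitePi_map_pi _ (fun k => measurable_of_countable _)]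
    simp_rw [map_add_uniformOn_univ]

/-! ### Functions that depend on finitely many coordinates -/

theorem mem_iff_of_measurableSet_filt {g : GenSeq} {k : ℕ} {s : Set (G g)}
    (hs : MeasurableSet[filt g k] s) {x y : G g} (hxy : ∀ j < k, y j = x j) : y ∈ s ↔ x ∈ s := by
  have hs' : MeasurableSet[MeasurableSpace.generateFrom (Set.range (interval g k))] s := hs
  induction s, hs' using MeasurableSpace.generateFrom_induction with
  | hC t ht _ =>
    obtain ⟨z, rfl⟩ := ht
    exact forall₂_congr fun j hj => by rw [hxy j hj]
  | empty => simp
  | compl t ht ih => exact not_congr (ih ht)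
  | iUnion t ht ih => simp only [Set.mem_iUnion]; exact exists_congr fun i => ih i (ht i)

theorem stronglyMeasurable_filt {g : GenSeq} {k : ℕ} {F : G g → ℂ}
    (hF : ∀ x y, (∀ j < k, y j = x j) → F y = F x) : StronglyMeasurable[filt g k] F := by
  suffices h : Measurable[filt g k] F from h.stronglyMeasurable
  intro s _
  have h : F ⁻¹' s = ⋃₀ (interval g k '' (F ⁻¹' s)) := by
    ext y
    constructor
    · intro hy
      exact ⟨_, ⟨y, hy, rfl⟩, fun _ _ => rfl⟩
    · rintro ⟨_, ⟨z, hz, rfl⟩, hy⟩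
      rw [Set.mem_preimage, hF z y hy]; exact hz
  rw [h]
  refine @Set.Finite.measurableSet_sUnion _ (filt g k) _
    ((finite_range_interval g k).subset (Set.image_subset_range _ _)) ?_
  rintro _ ⟨z, -, rfl⟩
  exact MeasurableSpace.measurableSet_generateFrom ⟨z, rfl⟩

theorem eq_of_stronglyMeasurable_filt {g : GenSeq} {k : ℕ} {F : G g → ℂ}
    (hF : StronglyMeasurable[filt g k] F) {x y : G g} (hxy : ∀ j < k, y j = x j) : F y = F x :=
  (mem_iff_of_measurableSet_filt (hF.measurable (measurableSet_singleton (F x))) hxy).2 rfl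

/-- Translation in a coordinate `l ≥ k` preserves both `s` and the measure, so the integral equals
`w ≠ 1` times itself. Orthogonality of the `ψ_i` and the formula for conditional expectations both
rest on this. -/
theorem setIntegral_eq_zero_of_quasiInvariant {g : GenSeq} {k l : ℕ} (hkl : k ≤ l) {F : G g → ℂ}
    {w : ℂ} (hw : w ≠ 1) (hF : ∀ x, F (x + Pi.single l 1) = w * F x) {s : Set (G g)}
    (hs : MeasurableSet[filt g k] s) : ∫ x in s, F x ∂(haar g) = 0 := by
  have hs' := (filt g).le k s hs
  rw [← integral_indicator hs']
  have h1 : ∀ x, s.indicator F (x + Pi.single l 1) = w * s.indicator F x := by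
    intro x
    have : x + Pi.single l 1 ∈ s ↔ x ∈ s := mem_iff_of_measurableSet_filt hs fun j hj => by
      rw [Pi.add_apply, Pi.single_eq_of_ne (by omega), add_zero]
    by_cases hx : x ∈ s
    · rw [Set.indicator_of_mem hx, Set.indicator_of_mem (this.2 hx), hF]
    · rw [Set.indicator_of_notMem hx, Set.indicator_of_notMem (fun h => hx (this.1 h)), mul_zero]
  have h2 := integral_add_right_eq_self (μ := haar g) (s.indicator F) (Pi.single l 1)
  simp_rw [h1, integral_const_mul] at h2
  by_contra h0
  exact hw (mul_right_cancel₀ h0 (h2.trans (one_mul _).symm))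

theorem integral_eq_zero_of_quasiInvariant {g : GenSeq} {l : ℕ} {F : G g → ℂ}
    {w : ℂ} (hw : w ≠ 1) (hF : ∀ x, F (x + Pi.single l 1) = w * F x) :
    ∫ x, F x ∂(haar g) = 0 := by
  rw [← setIntegral_univ]
  exact setIntegral_eq_zero_of_quasiInvariant le_rfl hw hF MeasurableSet.univ

theorem integral_psi_mul_conj_psi (g : GenSeq) (i j : ℕ) :
    ∫ x, psi g i x * conj (psi g j x) ∂(haar g) = if i = j then 1 else 0 := by
  split_ifs with h
  · subst h
    simp [Complex.mul_conj, Complex.normSq_eq_norm_sq, norm_psi]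
  · have hi := (lt_M_self g i).trans_le (M_mono g (by omega : i ≤ i + j))
    have hj := (lt_M_self g j).trans_le (M_mono g (by omega : j ≤ i + j))
    obtain ⟨l, -, hl⟩ := exists_digit_ne hi hj h
    set z : ℂ := ZMod.stdAddChar (1 : ZMod (g.m l)) with hz
    have hzn : z * conj z = 1 := by
      rw [hz, ZMod.stdAddChar_apply, Complex.mul_conj, Complex.normSq_eq_norm_sq, Circle.norm_coe]
      simp
    refine integral_eq_zero_of_quasiInvariant (l := l)
      (w := z ^ digit g i l * conj z ^ digit g j l) ?_ ?_
    · intro hc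
      apply stdAddChar_pow_ne (digit_lt g i l) (digit_lt g j l) hl
      calc z ^ digit g i l = z ^ digit g i l * (z * conj z) ^ digit g j l := by
            rw [hzn, one_pow, mul_one]
        _ = (z ^ digit g i l * conj z ^ digit g j l) * z ^ digit g j l := by ring
        _ = _ := by rw [hc, one_mul]
    · intro x
      rw [psi_add, psi_add, psi_single, psi_single, map_mul, map_pow]; ring

/-! ### Vilenkin polynomials -/

/-- The Vilenkin polynomial `∑_{i<A} c_i ψ_i`. -/
noncomputable def poly (g : GenSeq) (c : ℕ → ℂ) (A : ℕ) (x : G g) : ℂ :=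
  ∑ i ∈ Finset.range A, c i * psi g i x

theorem measurable_poly (g : GenSeq) (c : ℕ → ℂ) (A : ℕ) : Measurable (poly g c A) := by
  unfold poly
  exact Finset.measurable_sum _ fun i _ => (measurable_psi g i).const_mul _

theorem integrable_psi (g : GenSeq) (i : ℕ) : Integrable (psi g i) (haar g) :=
  Integrable.of_bound (measurable_psi g i).aestronglyMeasurable 1
    (Eventually.of_forall fun x => (norm_psi g i x).le)

theorem integrable_poly (g : GenSeq) (c : ℕ → ℂ) (A : ℕ) : Integrable (poly g c A) (haar g) := by
  unfold poly
  exact integrable_finsetSum _ fun i _ => (integrable_psi g i).const_mul _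

theorem integral_poly_mul_conj_psi (g : GenSeq) (c : ℕ → ℂ) {A i : ℕ} (hi : i < A) :
    ∫ x, poly g c A x * conj (psi g i x) ∂(haar g) = c i := by
  simp_rw [poly, Finset.sum_mul, mul_assoc]
  rw [integral_finsetSum]
  · simp_rw [integral_const_mul, integral_psi_mul_conj_psi]
    simp [hi]
  · intro j _
    refine Integrable.const_mul (Integrable.of_bound ?_ 1 (Eventually.of_forall fun x => ?_)) _
    · exact ((measurable_psi g j).mul
        (Complex.continuous_conj.measurable.comp (measurable_psi g i))).aestronglyMeasurable
    · rw [norm_mul, RCLike.norm_conj, norm_psi, norm_psi, mul_one]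

theorem poly_congr_coord {g : GenSeq} (c : ℕ → ℂ) {A k : ℕ} (hA : A ≤ M g k) (x y : G g)
    (hxy : ∀ j < k, y j = x j) : poly g c A y = poly g c A x :=
  Finset.sum_congr rfl fun i hi => by
    rw [psi_congr ((Finset.mem_range.1 hi).trans_le hA) hxy]

theorem setIntegral_psi_eq_zero {g : GenSeq} {i k : ℕ} (hki : M g k ≤ i) {s : Set (G g)}
    (hs : MeasurableSet[filt g k] s) : ∫ x in s, psi g i x ∂(haar g) = 0 := by
  have h1 : 1 ≤ i := (M_pos g k).trans_le hki
  have hk : k ≤ hi g i := by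
    have := (M_strictMono g).lt_iff_lt.1 (hki.trans_lt (lt_M_hi_succ g i)); omega
  refine setIntegral_eq_zero_of_quasiInvariant hk
    (w := ZMod.stdAddChar (1 : ZMod (g.m (hi g i))) ^ digit g i (hi g i)) ?_ ?_ hs
  · have := stdAddChar_pow_ne (digit_lt g i (hi g i)) (m_pos g (hi g i)) (digit_hi_ne_zero g h1)
    rwa [pow_zero] at this
  · intro x; rw [psi_add, psi_single, mul_comm]

theorem condExp_poly (g : GenSeq) (c : ℕ → ℂ) (A k : ℕ) :
    (haar g)[poly g c A | filt g k] =ᵐ[haar g] poly g c (min A (M g k)) := by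
  symm
  refine ae_eq_condExp_of_forall_setIntegral_eq ((filt g).le k) (integrable_poly g c A)
    (fun s _ _ => (integrable_poly g c _).integrableOn) ?_
    (stronglyMeasurable_filt (poly_congr_coord c (min_le_right _ _))).aestronglyMeasurable
  intro s hs _
  have h : ∀ B, ∫ x in s, poly g c B x ∂(haar g)
      = ∑ i ∈ Finset.range B, c i * ∫ x in s, psi g i x ∂(haar g) := by
    intro B
    simp_rw [poly]
    rw [integral_finsetSum _ fun i _ => ((integrable_psi g i).const_mul _).integrableOn]
    simp_rw [integral_const_mul]
  rw [h, h]
  refine Finset.sum_subset (Finset.range_mono (min_le_left _ _)) fun i hi hi' => ?_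
  rw [Finset.mem_range] at hi hi'
  rw [setIntegral_psi_eq_zero (by omega) hs, mul_zero]

/-- The Dirichlet kernel. -/
noncomputable def dirichlet (g : GenSeq) (n : ℕ) (x : G g) : ℂ := ∑ i ∈ Finset.range n, psi g i x

theorem dirichlet_M_succ (g : GenSeq) (K : ℕ) (x : G g) :
    dirichlet g (M g (K + 1)) x
      = (∑ t ∈ Finset.range (g.m K), rademacher g K x ^ t) * dirichlet g (M g K) x := by
  rw [dirichlet, sum_range_M_succ, Finset.sum_mul]
  refine Finset.sum_congr rfl fun t ht => ?_
  rw [dirichlet, Finset.mul_sum]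
  exact Finset.sum_congr rfl fun i hi => psi_mul_add (Finset.mem_range.1 ht) (Finset.mem_range.1 hi) x

theorem rademacher_pow_m (g : GenSeq) (k : ℕ) (x : G g) : rademacher g k x ^ g.m k = 1 := by
  rw [rademacher_eq, ← AddChar.map_nsmul_eq_pow]; simp

theorem rademacher_eq_one_iff {g : GenSeq} {k : ℕ} {x : G g} : rademacher g k x = 1 ↔ x k = 0 := by
  rw [rademacher_eq, ← AddChar.map_zero_eq_one (ZMod.stdAddChar : AddChar (ZMod (g.m k)) ℂ)]
  exact ZMod.injective_stdAddChar.eq_iff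

theorem sum_rademacher_pow (g : GenSeq) (k : ℕ) (x : G g) :
    ∑ t ∈ Finset.range (g.m k), rademacher g k x ^ t = if x k = 0 then (g.m k : ℂ) else 0 := by
  split_ifs with h
  · rw [rademacher_eq_one_iff.2 h]; simp
  · rw [geom_sum_eq (fun hc => h (rademacher_eq_one_iff.1 hc)), rademacher_pow_m, sub_self, zero_div]

theorem dirichlet_M (g : GenSeq) (K : ℕ) (x : G g) :
    dirichlet g (M g K) x = (interval g K 0).indicator (fun _ => (M g K : ℂ)) x := by
  induction K with
  | zero =>
    simp [M_zero, dirichlet, psi_zero, interval]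
  | succ K ih =>
    rw [dirichlet_M_succ, ih, sum_rademacher_pow]
    by_cases h : x ∈ interval g K 0
    · by_cases hK : x K = 0
      · rw [Set.indicator_of_mem h, if_pos hK, Set.indicator_of_mem, M_succ, Nat.cast_mul]
        intro k hk
        rcases Nat.lt_succ_iff_lt_or_eq.1 hk with hk | rfl
        · exact h k hk
        · exact hK
      · rw [if_neg hK, zero_mul, Set.indicator_of_notMem]
        exact fun hc => hK (hc K (Nat.lt_succ_self K))
    · rw [Set.indicator_of_notMem h, mul_zero, Set.indicator_of_notMem]
      exact fun hc => h fun k hk => hc k (hk.trans (Nat.lt_succ_self K))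

theorem haar_interval (g : GenSeq) (k : ℕ) (x : G g) :
    haar g (interval g k x) = (M g k : ℝ≥0∞)⁻¹ := by
  have h : interval g k x = Set.pi (Finset.range k : Set ℕ) fun j => {x j} := by
    ext y; simp [interval]
  rw [h, haar, Measure.infinitePi_pi _ fun i _ => measurableSet_singleton _, M, Nat.cast_prod,
    ENNReal.prod_inv_distrib]
  · refine Finset.prod_congr rfl fun j _ => ?_
    rw [uniformOn_univ, Measure.count_singleton, ZMod.card, one_div]
  · intro i _ j _ _
    exact Or.inr (ENNReal.natCast_ne_top _)

theorem sum_psi_mul_conj_psi (g : GenSeq) (k : ℕ) (x y : G g) :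
    ∑ i ∈ Finset.range (M g k), psi g i x * conj (psi g i y)
      = (interval g k x).indicator (fun _ => (M g k : ℂ)) y := by
  have h1 : ∀ i, psi g i x * conj (psi g i y) = psi g i (x - y) := by
    intro i
    have h2 : psi g i x = psi g i (x - y) * psi g i y := by rw [← psi_add, sub_add_cancel]
    rw [h2, mul_assoc, Complex.mul_conj, Complex.normSq_eq_norm_sq, norm_psi]; simp
  simp_rw [h1]
  have h3 := dirichlet_M g k (x - y)
  rw [dirichlet] at h3
  rw [h3]
  have h4 : x - y ∈ interval g k 0 ↔ y ∈ interval g k x :=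
    forall₂_congr fun j _ => by
      rw [Pi.sub_apply, Pi.zero_apply, sub_eq_zero, eq_comm]
  by_cases h : y ∈ interval g k x
  · rw [Set.indicator_of_mem h, Set.indicator_of_mem (h4.2 h)]
  · rw [Set.indicator_of_notMem h, Set.indicator_of_notMem (fun hc => h (h4.1 hc))]

/-- `∑_{i<M_k} ψ_i(x) conj ψ_i(y)` is `M_k` times the indicator of `I_k(x)`, hence a reproducing
kernel for functions constant on these intervals. The identity is pointwise, not merely almost
everywhere. -/
theorem eq_poly_of_stronglyMeasurable {g : GenSeq} {k : ℕ} {F : G g → ℂ}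
    (hF : StronglyMeasurable[filt g k] F) (hint : Integrable F (haar g)) :
    F = poly g (fun i => ∫ y, F y * conj (psi g i y) ∂(haar g)) (M g k) := by
  ext x
  have hI : ∀ i, Integrable (fun y => F y * conj (psi g i y)) (haar g) := fun i =>
    hint.mul_bdd (c := 1)
      (Complex.continuous_conj.measurable.comp (measurable_psi g i)).aestronglyMeasurable
      (Eventually.of_forall fun y => by simp [norm_psi])
  have h1 : ∀ i, (∫ y, F y * conj (psi g i y) ∂(haar g)) * psi g i x
      = ∫ y, F y * (psi g i x * conj (psi g i y)) ∂(haar g) := by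
    intro i
    rw [← integral_mul_const]
    congr 1; ext y; ring
  simp_rw [poly, h1]
  rw [← integral_finsetSum]
  · simp_rw [← Finset.mul_sum, sum_psi_mul_conj_psi]
    have h2 : ∀ y, F y * (interval g k x).indicator (fun _ => (M g k : ℂ)) y
        = (interval g k x).indicator (fun _ => F x * M g k) y := by
      intro y
      by_cases h : y ∈ interval g k x
      · rw [Set.indicator_of_mem h, Set.indicator_of_mem h, eq_of_stronglyMeasurable_filt hF h]
      · rw [Set.indicator_of_notMem h, Set.indicator_of_notMem h, mul_zero]
    simp_rw [h2]
    rw [integral_indicator_const _ (measurableSet_interval g k x), measureReal_def, haar_interval]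
    have : (M g k : ℝ) ≠ 0 := by exact_mod_cast (M_pos g k).ne'
    rw [ENNReal.toReal_inv, ENNReal.toReal_natCast, Complex.real_smul]
    push_cast
    have h3 : (M g k : ℂ) ≠ 0 := by exact_mod_cast (M_pos g k).ne'
    field_simp
  · intro i _
    have := (hI i).mul_const (psi g i x)
    refine this.congr (Eventually.of_forall fun y => ?_)
    ring

/-! ### Martingales and their Fourier coefficients -/

theorem coeff_eq_of_eventually {g : GenSeq} {f : ℕ → G g → ℂ} {i : ℕ} {a : ℂ} {K : ℕ}
    (h : ∀ k, K ≤ k → ∫ x, f k x * conj (psi g i x) ∂(haar g) = a) : coeff g f i = a :=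
  (tendsto_const_nhds.congr' ((eventually_ge_atTop K).mono fun k hk => (h k hk).symm)).limUnder_eq

theorem martingale_eq_poly {g : GenSeq} {f : ℕ → G g → ℂ} (hf : Martingale f (filt g) (haar g))
    (k : ℕ) : f k = poly g (coeff g f) (M g k) := by
  have h0 : ∀ k, f k = poly g (fun i => ∫ y, f k y * conj (psi g i y) ∂(haar g)) (M g k) :=
    fun k => eq_poly_of_stronglyMeasurable (hf.stronglyMeasurable k) (hf.integrable k)
  rw [h0 k]
  refine funext fun x => Finset.sum_congr rfl fun i hi => ?_
  congr 1
  symm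
  refine coeff_eq_of_eventually (K := k) fun k' hk' => ?_
  -- The martingale property and `condExp_poly` identify the polynomials of `f k'` and `f k` below
  -- degree `M g k`, so the integrals defining the coefficient are constant from level `k` on.
  have h1 := hf.condExp_ae_eq hk'
  rw [h0 k'] at h1
  have h2 := (condExp_poly g _ (M g k') k).symm.trans h1
  rw [min_eq_right (M_mono g hk')] at h2
  have h3 := integral_poly_mul_conj_psi g
    (fun i => ∫ y, f k' y * conj (psi g i y) ∂(haar g)) (Finset.mem_range.1 hi)
  exact h3.symm.trans (integral_congr_ae (h2.mono fun x hx => by simp only [hx]))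

theorem martingale_poly (g : GenSeq) (c : ℕ → ℂ) :
    Martingale (fun n => poly g c (M g n)) (filt g) (haar g) := by
  refine ⟨fun n => stronglyMeasurable_filt (poly_congr_coord c le_rfl), fun i j hij => ?_⟩
  have := condExp_poly g c (M g j) i
  rwa [min_eq_right (M_mono g hij)] at this

theorem coeff_poly (g : GenSeq) (c : ℕ → ℂ) : coeff g (fun n => poly g c (M g n)) = c := by
  ext i
  exact coeff_eq_of_eventually (K := i) fun k hk =>
    integral_poly_mul_conj_psi g c ((lt_M_self g i).trans_le (M_mono g hk))

theorem fejer_eq_poly (g : GenSeq) (f : ℕ → G g → ℂ) (n : ℕ) :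
    fejer g f n = poly g (fun i => (1 / (n : ℂ)) * (((n : ℂ) - i) * coeff g f i)) n := by
  have key : ∀ (a : ℕ → ℂ) (n : ℕ), ∑ k ∈ Finset.Icc 1 n, ∑ i ∈ Finset.range k, a i
      = ∑ i ∈ Finset.range n, ((n : ℂ) - i) * a i := by
    intro a n
    induction n with
    | zero => simp
    | succ n ih =>
      rw [Finset.sum_Icc_succ_top (by omega), ih, Finset.sum_range_succ, Finset.sum_range_succ,
        ← add_assoc, ← Finset.sum_add_distrib]
      push_cast
      congr 1
      · exact Finset.sum_congr rfl fun i _ => by ring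
      · ring
  ext x
  simp only [fejer, partialSum, poly]
  rw [key, Finset.mul_sum]
  exact Finset.sum_congr rfl fun i _ => by ring

/-! ### Geometric growth of the numbers `M_k` -/

theorem M_cast_pos (g : GenSeq) (k : ℕ) : (0 : ℝ) < M g k := by exact_mod_cast M_pos g k

theorem two_mul_M_cast_le (g : GenSeq) (k : ℕ) : (2 : ℝ) * M g k ≤ M g (k + 1) := by
  exact_mod_cast two_mul_M_le g k

theorem M_succ_cast_le {g : GenSeq} {L : ℕ} (hL : ∀ k, g.m k ≤ L) (k : ℕ) :
    (M g (k + 1) : ℝ) ≤ L * M g k := by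
  rw [M_succ]; exact_mod_cast Nat.mul_le_mul_right _ (hL k)

theorem two_rpow_sub_one_pos {q : ℝ} (hq : 0 < q) : 0 < (2 : ℝ) ^ q - 1 :=
  sub_pos.2 (Real.one_lt_rpow one_lt_two hq)

theorem sum_M_rpow_le (g : GenSeq) {q : ℝ} (hq : 0 < q) (K : ℕ) :
    ∑ l ∈ Finset.range K, (M g l : ℝ) ^ q ≤ (M g K : ℝ) ^ q / (2 ^ q - 1) := by
  have h2 := two_rpow_sub_one_pos hq
  rw [le_div_iff₀ h2]
  induction K with
  | zero => simp [Real.rpow_nonneg]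
  | succ K ih =>
    rw [Finset.sum_range_succ]
    have h3 : (2 : ℝ) ^ q * (M g K : ℝ) ^ q ≤ (M g (K + 1) : ℝ) ^ q := by
      rw [← Real.mul_rpow zero_le_two (M_cast_pos g K).le]
      exact Real.rpow_le_rpow (by positivity) (two_mul_M_cast_le g K) hq.le
    linarith

theorem sum_M_rpow_neg_le (g : GenSeq) {q : ℝ} (hq : 0 < q) (s d : ℕ) :
    ∑ j ∈ Finset.range d, (M g (s + j) : ℝ) ^ (-q)
      ≤ (M g s : ℝ) ^ (-q) * (2 ^ q / (2 ^ q - 1)) := by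
  have h2 := two_rpow_sub_one_pos hq
  have h3 : ∀ j, (2 : ℝ) ^ q * (M g (j + 1) : ℝ) ^ (-q) ≤ (M g j : ℝ) ^ (-q) := by
    intro j
    have h4 : (M g (j + 1) : ℝ) ^ (-q) ≤ (2 * M g j : ℝ) ^ (-q) :=
      Real.rpow_le_rpow_of_nonpos (by have := M_cast_pos g j; positivity)
        (two_mul_M_cast_le g j) (by linarith)
    calc (2 : ℝ) ^ q * (M g (j + 1) : ℝ) ^ (-q) ≤ 2 ^ q * (2 * M g j : ℝ) ^ (-q) := by gcongr
      _ = _ := by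
        rw [Real.mul_rpow zero_le_two (M_cast_pos g j).le, ← mul_assoc,
          ← Real.rpow_add zero_lt_two]
        simp
  have h5 : (∑ j ∈ Finset.range d, (M g (s + j) : ℝ) ^ (-q)) * (2 ^ q - 1)
      ≤ 2 ^ q * ((M g s : ℝ) ^ (-q) - (M g (s + d) : ℝ) ^ (-q)) := by
    induction d with
    | zero => simp
    | succ d ih =>
      rw [Finset.sum_range_succ, add_mul]
      have := h3 (s + d)
      rw [← add_assoc]
      linarith
  rw [← mul_div_assoc, le_div_iff₀ h2]
  refine h5.trans ?_
  have : (0 : ℝ) ≤ (2 : ℝ) ^ q * (M g (s + d) : ℝ) ^ (-q) := by positivity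
  linarith

/-! ### The `p`-th power integral -/

/-- The integral of `|F| ^ p`. -/
noncomputable def powInt (g : GenSeq) (p : ℝ) (F : G g → ℂ) : ℝ≥0∞ :=
  ∫⁻ x, ‖F x‖ₑ ^ p ∂(haar g)

theorem enorm_add_rpow_le {p : ℝ} (hp : 0 < p) (hp1 : p ≤ 1) (a b : ℂ) :
    ‖a + b‖ₑ ^ p ≤ ‖a‖ₑ ^ p + ‖b‖ₑ ^ p :=
  (ENNReal.rpow_le_rpow (enorm_add_le a b) hp.le).trans
    (ENNReal.rpow_add_le_add_rpow _ _ hp.le hp1)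

theorem enorm_sum_rpow_le {ι : Type*} {p : ℝ} (hp : 0 < p) (hp1 : p ≤ 1) (s : Finset ι)
    (F : ι → ℂ) : ‖∑ i ∈ s, F i‖ₑ ^ p ≤ ∑ i ∈ s, ‖F i‖ₑ ^ p := by
  classical
  induction s using Finset.induction_on with
  | empty => simp [hp]
  | insert a s ha ih =>
    rw [Finset.sum_insert ha, Finset.sum_insert ha]
    exact (enorm_add_rpow_le hp hp1 _ _).trans (by gcongr)

theorem enorm_rpow_eq {p : ℝ} (hp : 0 < p) (a : ℂ) : ‖a‖ₑ ^ p = ENNReal.ofReal (‖a‖ ^ p) := by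
  rw [← ofReal_norm, ENNReal.ofReal_rpow_of_nonneg (norm_nonneg a) hp.le]

section

variable {g : GenSeq} {p : ℝ}

theorem powInt_add_le (hp : 0 < p) (hp1 : p ≤ 1) {F H : G g → ℂ} (hF : Measurable F) :
    powInt g p (fun x => F x + H x) ≤ powInt g p F + powInt g p H := by
  unfold powInt
  rw [← lintegral_add_left (hF.enorm.pow_const p)]
  exact lintegral_mono fun x => enorm_add_rpow_le hp hp1 _ _

theorem powInt_sum_le {ι : Type*} (hp : 0 < p) (hp1 : p ≤ 1) (s : Finset ι) {F : ι → G g → ℂ}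
    (hF : ∀ i, Measurable (F i)) :
    powInt g p (fun x => ∑ i ∈ s, F i x) ≤ ∑ i ∈ s, powInt g p (F i) := by
  unfold powInt
  rw [← lintegral_finsetSum _ fun i _ => (hF i).enorm.pow_const p]
  exact lintegral_mono fun x => enorm_sum_rpow_le hp hp1 _ _

theorem powInt_const_mul (hp : 0 < p) (a : ℂ) {F : G g → ℂ} (hF : Measurable F) :
    powInt g p (fun x => a * F x) = ENNReal.ofReal (‖a‖ ^ p) * powInt g p F := by
  unfold powInt
  rw [← enorm_rpow_eq hp, ← lintegral_const_mul _ (hF.enorm.pow_const p)]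
  simp_rw [enorm_mul, ENNReal.mul_rpow_of_nonneg _ _ hp.le]

theorem powInt_congr_norm {F H : G g → ℂ} (h : ∀ x, ‖F x‖ = ‖H x‖) :
    powInt g p F = powInt g p H := by
  unfold powInt
  simp_rw [← ofReal_norm, h]

theorem powInt_translate (F : G g → ℂ) (a : G g) :
    powInt g p (fun x => F (x + a)) = powInt g p F :=
  lintegral_add_right_eq_self (μ := haar g) (fun x => ‖F x‖ₑ ^ p) a

/-! ### Projections onto a fixed digit and the multiplier `i ↦ i` -/

theorem poly_slice (c : ℕ → ℂ) (A l : ℕ) {t : ℕ} (ht : t < g.m l) (x : G g) :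
    poly g (fun i => if digit g i l = t then c i else 0) A x
      = ∑ s : ZMod (g.m l), ((g.m l : ℂ)⁻¹ * conj (ZMod.stdAddChar s : ℂ) ^ t)
          * poly g c A (x + Pi.single l s) := by
  simp_rw [poly, Finset.mul_sum, psi_add, psi_single]
  rw [Finset.sum_comm]
  refine Finset.sum_congr rfl fun i _ => ?_
  have h1 := sum_stdAddChar_pow_mul (digit_lt g i l) ht
  have h2 : ∀ s : ZMod (g.m l), (g.m l : ℂ)⁻¹ * conj (ZMod.stdAddChar s : ℂ) ^ t
      * (c i * (psi g i x * ZMod.stdAddChar s ^ digit g i l))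
      = ((g.m l : ℂ)⁻¹ * c i * psi g i x)
        * (ZMod.stdAddChar s ^ digit g i l * conj (ZMod.stdAddChar s : ℂ) ^ t) := fun s => by ring
  simp_rw [h2, ← Finset.mul_sum, h1]
  have h3 : (g.m l : ℂ) ≠ 0 := by exact_mod_cast (m_pos g l).ne'
  split_ifs
  · field_simp
  · ring

/-- By Fourier inversion on `ℤ / m_l`, the slice is a sum of `m_l` translates with weights of
modulus `1 / m_l`; `p`-subadditivity gives `m_l * m_l^(-p)`. -/
theorem powInt_slice_le (hp : 0 < p) (hp1 : p ≤ 1) (c : ℕ → ℂ) (A l : ℕ) {t : ℕ}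
    (ht : t < g.m l) :
    powInt g p (poly g (fun i => if digit g i l = t then c i else 0) A)
      ≤ ENNReal.ofReal ((g.m l : ℝ) ^ (1 - p)) * powInt g p (poly g c A) := by
  have hm : (0 : ℝ) < g.m l := by exact_mod_cast m_pos g l
  have hmeas : ∀ s : ZMod (g.m l), Measurable fun x : G g => poly g c A (x + Pi.single l s) := by
    intro s
    have h : Measurable fun x : G g => x + Pi.single l s := by
      refine measurable_pi_lambda _ fun k => ?_
      exact (measurable_of_countable (fun z : ZMod (g.m k) =>
        z + (Pi.single l s : G g) k)).comp (measurable_pi_apply k)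
    exact (measurable_poly g c A).comp h
  rw [funext (poly_slice c A l ht)]
  refine (powInt_sum_le hp hp1 _ fun s => (hmeas s).const_mul _).trans ?_
  have h1 : ∀ s : ZMod (g.m l), powInt g p (fun x => ((g.m l : ℂ)⁻¹ *
      conj (ZMod.stdAddChar s : ℂ) ^ t) * poly g c A (x + Pi.single l s))
      = ENNReal.ofReal ((g.m l : ℝ) ^ (-p)) * powInt g p (poly g c A) := by
    intro s
    rw [powInt_const_mul hp _ (hmeas s), powInt_translate, norm_mul, norm_inv, norm_pow,
      RCLike.norm_conj, ZMod.stdAddChar_apply, Circle.norm_coe, one_pow, mul_one,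
      Complex.norm_natCast, Real.inv_rpow hm.le, Real.rpow_neg hm.le]
  simp_rw [h1]
  rw [Finset.sum_const, Finset.card_univ, ZMod.card, nsmul_eq_mul, ← mul_assoc,
    ← ENNReal.ofReal_natCast, ← ENNReal.ofReal_mul hm.le, sub_eq_add_neg,
    Real.rpow_add hm, Real.rpow_one]

theorem nat_rpow_one_sub_le {L m : ℕ} (hm : 1 ≤ m) (h : m ≤ L) (hp : 0 < p) :
    (m : ℝ) ^ (1 - p) ≤ L := by
  calc (m : ℝ) ^ (1 - p) ≤ (m : ℝ) ^ (1 : ℝ) :=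
        Real.rpow_le_rpow_of_exponent_le (by exact_mod_cast hm) (by linarith)
    _ = m := Real.rpow_one _
    _ ≤ L := by exact_mod_cast h

/-- Expand `i = ∑ i_l M_l` and sort by the value `t` of each digit. A slice costs at most `L * (L
M_l)^p`, there are at most `L` of them for each `l`, and `∑_{l<K} M_l^p` is geometric. -/
theorem powInt_index_mul_le {L : ℕ} (hL : ∀ k, g.m k ≤ L) (hp : 0 < p) (hp1 : p ≤ 1)
    (c : ℕ → ℂ) (K : ℕ) :
    powInt g p (poly g (fun i => (i : ℂ) * c i) (M g K))
      ≤ ENNReal.ofReal ((L : ℝ) ^ (2 : ℕ) * (L : ℝ) ^ p / (2 ^ p - 1) * (M g K : ℝ) ^ p)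
        * powInt g p (poly g c (M g K)) := by
  set N := powInt g p (poly g c (M g K)) with hN
  have h1 : poly g (fun i => (i : ℂ) * c i) (M g K)
      = fun x => ∑ l ∈ Finset.range K, ∑ t ∈ Finset.range (g.m l),
        (((t * M g l : ℕ) : ℂ)) * poly g (fun i => if digit g i l = t then c i else 0) (M g K) x := by
    ext x
    simp_rw [poly, Finset.mul_sum]
    have h2 : ∀ l, ∑ t ∈ Finset.range (g.m l), ∑ i ∈ Finset.range (M g K),
        ((t * M g l : ℕ) : ℂ) * ((if digit g i l = t then c i else 0) * psi g i x)
        = ∑ i ∈ Finset.range (M g K), ((digit g i l * M g l : ℕ) : ℂ) * (c i * psi g i x) := by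
      intro l
      rw [Finset.sum_comm]
      refine Finset.sum_congr rfl fun i _ => ?_
      rw [Finset.sum_eq_single (digit g i l)]
      · rw [if_pos rfl]
      · intro t _ ht
        rw [if_neg ht.symm]; ring
      · intro h
        exact absurd (Finset.mem_range.2 (digit_lt g i l)) h
    simp_rw [h2]
    rw [Finset.sum_comm]
    refine Finset.sum_congr rfl fun i hi => ?_
    rw [← Finset.sum_mul, ← Nat.cast_sum, sum_digit_mul_M g K (Finset.mem_range.1 hi), mul_assoc]
  rw [h1]
  have hL0 : (0 : ℝ) ≤ L := Nat.cast_nonneg L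
  have hmeas : ∀ (l t : ℕ), Measurable fun x : G g => ((t * M g l : ℕ) : ℂ) *
      poly g (fun i => if digit g i l = t then c i else 0) (M g K) x :=
    fun l t => (measurable_poly g _ _).const_mul _
  have h3 : ∀ l, powInt g p (fun x => ∑ t ∈ Finset.range (g.m l), ((t * M g l : ℕ) : ℂ) *
      poly g (fun i => if digit g i l = t then c i else 0) (M g K) x)
      ≤ ENNReal.ofReal ((L : ℝ) ^ (2 : ℕ) * (L : ℝ) ^ p * (M g l : ℝ) ^ p) * N := by
    intro l
    refine (powInt_sum_le hp hp1 _ fun t => hmeas l t).trans ?_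
    have h4 : ∀ t ∈ Finset.range (g.m l), powInt g p (fun x => ((t * M g l : ℕ) : ℂ) *
        poly g (fun i => if digit g i l = t then c i else 0) (M g K) x)
        ≤ ENNReal.ofReal ((L : ℝ) * (L : ℝ) ^ p * (M g l : ℝ) ^ p) * N := by
      intro t ht
      have ht' := Finset.mem_range.1 ht
      rw [powInt_const_mul hp _ (measurable_poly g _ _)]
      calc _ ≤ ENNReal.ofReal (‖((t * M g l : ℕ) : ℂ)‖ ^ p)
            * (ENNReal.ofReal ((g.m l : ℝ) ^ (1 - p)) * N) := by
              gcongr; exact powInt_slice_le hp hp1 c _ l ht'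
        _ ≤ _ := by
          rw [← mul_assoc, ← ENNReal.ofReal_mul (by positivity)]
          refine mul_le_mul' (ENNReal.ofReal_le_ofReal ?_) le_rfl
          rw [Complex.norm_natCast, mul_assoc, mul_comm]
          have h5 := nat_rpow_one_sub_le (m_pos g l) (hL l) hp
          refine mul_le_mul h5 ?_ (by positivity) hL0
          rw [← Real.mul_rpow hL0 (M_cast_pos g l).le, Nat.cast_mul]
          gcongr
          exact ht'.le.trans (hL l)
    refine (Finset.sum_le_sum h4).trans ?_
    rw [Finset.sum_const, Finset.card_range, nsmul_eq_mul, ← mul_assoc, ← ENNReal.ofReal_natCast,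
      ← ENNReal.ofReal_mul (Nat.cast_nonneg _)]
    refine mul_le_mul' (ENNReal.ofReal_le_ofReal ?_) le_rfl
    have : (g.m l : ℝ) ≤ L := by exact_mod_cast hL l
    calc (g.m l : ℝ) * (L * (L : ℝ) ^ p * (M g l : ℝ) ^ p)
        ≤ L * (L * (L : ℝ) ^ p * (M g l : ℝ) ^ p) := by gcongr
      _ = _ := by ring
  refine (powInt_sum_le hp hp1 _ fun l => Finset.measurable_sum _ fun t _ => hmeas l t).trans ?_
  refine (Finset.sum_le_sum fun l _ => h3 l).trans ?_
  rw [← Finset.sum_mul, ← ENNReal.ofReal_sum_of_nonneg (fun l _ => by positivity),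
    ← Finset.mul_sum]
  refine mul_le_mul' (ENNReal.ofReal_le_ofReal ?_) le_rfl
  calc _ ≤ (L : ℝ) ^ (2 : ℕ) * (L : ℝ) ^ p * ((M g K : ℝ) ^ p / (2 ^ p - 1)) := by
        gcongr; exact sum_M_rpow_le g hp K
    _ = _ := by ring

theorem poly_mul_add (c : ℕ → ℂ) {K a n : ℕ} (ha : a < g.m K) (hn : n ≤ M g K) (x : G g) :
    poly g c (a * M g K + n) x
      = ∑ t ∈ Finset.range a, rademacher g K x ^ t * poly g (fun i => c (t * M g K + i)) (M g K) x
        + rademacher g K x ^ a * poly g (fun i => c (a * M g K + i)) n x := by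
  simp_rw [poly]
  rw [sum_range_mul_add]
  simp_rw [Finset.mul_sum]
  congr 1
  · refine Finset.sum_congr rfl fun t ht => Finset.sum_congr rfl fun i hi => ?_
    rw [psi_mul_add ((Finset.mem_range.1 ht).trans ha) (Finset.mem_range.1 hi)]; ring
  · refine Finset.sum_congr rfl fun i hi => ?_
    rw [psi_mul_add ha ((Finset.mem_range.1 hi).trans_le hn)]; ring

/-- Up to the unimodular factor `r_K^t`, a block of coefficients is the slice of the whole
polynomial with `K`-th digit `t`. -/
theorem powInt_block_le (hp : 0 < p) (hp1 : p ≤ 1) (c : ℕ → ℂ) {K t : ℕ} (ht : t < g.m K) :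
    powInt g p (poly g (fun i => c (t * M g K + i)) (M g K))
      ≤ ENNReal.ofReal ((g.m K : ℝ) ^ (1 - p)) * powInt g p (poly g c (M g (K + 1))) := by
  refine le_trans (le_of_eq ?_) (powInt_slice_le hp hp1 c (M g (K + 1)) K ht)
  refine powInt_congr_norm fun x => ?_
  have h : poly g (fun i => if digit g i K = t then c i else 0) (M g (K + 1)) x
      = rademacher g K x ^ t * poly g (fun i => c (t * M g K + i)) (M g K) x := by
    simp_rw [poly]
    rw [sum_range_M_succ, Finset.sum_eq_single t, Finset.mul_sum]
    · refine Finset.sum_congr rfl fun i hi => ?_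
      rw [digit_mul_add ht (Finset.mem_range.1 hi), if_pos rfl,
        psi_mul_add ht (Finset.mem_range.1 hi)]
      ring
    · intro t' ht' hne
      refine Finset.sum_eq_zero fun i hi => ?_
      rw [digit_mul_add (Finset.mem_range.1 ht') (Finset.mem_range.1 hi), if_neg hne, zero_mul]
    · intro h
      exact absurd (Finset.mem_range.2 ht) h
  rw [h, norm_mul, norm_pow, norm_rademacher, one_pow, one_mul]

end

/-! ### Fejér means: the upper estimate -/

section

variable {g : GenSeq} {p : ℝ}

/-- The constant in the estimate of the multiplier `i ↦ i` on polynomials of degree `< M_K`. -/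
noncomputable def indexConst (L : ℕ) (p : ℝ) : ℝ := (L : ℝ) ^ (2 : ℕ) * (L : ℝ) ^ p / (2 ^ p - 1)

theorem indexConst_nonneg (L : ℕ) (hp : 0 < p) : 0 ≤ indexConst L p := by
  have := two_rpow_sub_one_pos hp
  unfold indexConst; positivity

theorem powInt_sub_index_mul_le {L : ℕ} (hL : ∀ k, g.m k ≤ L) (hp : 0 < p) (hp1 : p ≤ 1)
    (c : ℕ → ℂ) (K : ℕ) {a : ℂ} {A : ℝ} (ha : ‖a‖ ≤ A) :
    powInt g p (poly g (fun i => (a - i) * c i) (M g K))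
      ≤ ENNReal.ofReal (A ^ p + indexConst L p * (M g K : ℝ) ^ p)
        * powInt g p (poly g c (M g K)) := by
  have hA : 0 ≤ A := (norm_nonneg a).trans ha
  have hC := indexConst_nonneg L hp
  have h1 : poly g (fun i => (a - i) * c i) (M g K)
      = fun x => a * poly g c (M g K) x
        + (-1) * poly g (fun i => (i : ℂ) * c i) (M g K) x := by
    ext x
    simp_rw [poly, Finset.mul_sum]
    rw [← Finset.sum_add_distrib]
    exact Finset.sum_congr rfl fun i _ => by ring
  rw [h1]
  refine (powInt_add_le hp hp1 ((measurable_poly g _ _).const_mul _)).trans ?_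
  rw [powInt_const_mul hp _ (measurable_poly g _ _), powInt_const_mul hp _ (measurable_poly g _ _),
    ENNReal.ofReal_add (by positivity) (by positivity), add_mul, norm_neg, norm_one,
    Real.one_rpow, ENNReal.ofReal_one, one_mul]
  refine add_le_add ?_ (powInt_index_mul_le hL hp hp1 c K)
  exact mul_le_mul' (ENNReal.ofReal_le_ofReal (Real.rpow_le_rpow (norm_nonneg _) ha hp.le)) le_rfl

/-- The sum of `M_j ^ (2p-1)` over the nonzero digits `n_j`, `j < K`. -/
noncomputable def digitSum (g : GenSeq) (p : ℝ) (K n : ℕ) : ℝ :=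
  ∑ j ∈ Finset.range K, if digit g n j = 0 then 0 else (M g j : ℝ) ^ (2 * p - 1)

theorem digitSum_nonneg (g : GenSeq) (p : ℝ) (K n : ℕ) : 0 ≤ digitSum g p K n :=
  Finset.sum_nonneg fun j _ => by split_ifs <;> positivity

/-- Induction on the number of digits, with `c` general because the incomplete last block brings in
shifted coefficients. Each descent into a block costs `m_K^(1-p)`, and these factors multiply up to
the power `M_K^(1-p)`. -/
theorem powInt_fejer_sum_le {L : ℕ} (hL : ∀ k, g.m k ≤ L) (hp : 0 < p) (hp1 : p ≤ 1) (K : ℕ) :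
    ∀ (c : ℕ → ℂ) (n : ℕ), n < M g K →
    powInt g p (poly g (fun i => ((n : ℂ) - i) * c i) n)
      ≤ ENNReal.ofReal (L * ((L : ℝ) ^ p + indexConst L p) * (M g K : ℝ) ^ (1 - p)
        * digitSum g p K n) * powInt g p (poly g c (M g K)) := by
  have hC := indexConst_nonneg L hp
  induction K with
  | zero =>
    intro c n hn
    rw [M_zero, Nat.lt_one_iff] at hn
    subst hn
    simp [poly, powInt, hp]
  | succ K ih =>
    intro c n hn
    set N := powInt g p (poly g c (M g (K + 1))) with hN
    have hmK : (0 : ℝ) < g.m K := by exact_mod_cast m_pos g K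
    have hMK := M_cast_pos g K
    set a := n / M g K with ha_def
    set n' := n % M g K with hn'_def
    have hn' : n' < M g K := Nat.mod_lt _ (M_pos g K)
    have han : n = a * M g K + n' := by rw [mul_comm]; exact (Nat.div_add_mod _ _).symm
    have ha : a < g.m K := by
      rw [ha_def, Nat.div_lt_iff_lt_mul (M_pos g K), ← M_succ]; exact hn
    have hdig : digit g n K = a := by rw [han]; exact digit_mul_add ha hn'
    -- With `n = a M_K + n'` there are `a` complete blocks, with multiplier `(n - t M_K) - i`, and
    -- one incomplete block, where the multiplier is again of the form `n' - i`.
    have h1 : poly g (fun i => ((n : ℂ) - i) * c i) n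
        = fun x => ∑ t ∈ Finset.range a, rademacher g K x ^ t
            * poly g (fun i => (((n : ℂ) - (t * M g K : ℕ)) - i) * c (t * M g K + i)) (M g K) x
          + rademacher g K x ^ a * poly g (fun i => ((n' : ℂ) - i) * c (a * M g K + i)) n' x := by
      ext x
      conv_lhs => rw [show poly g (fun i => ((n : ℂ) - i) * c i) n x
        = poly g (fun i => ((n : ℂ) - i) * c i) (a * M g K + n') x by rw [← han]]
      rw [poly_mul_add _ ha hn'.le]
      congr 1
      · refine Finset.sum_congr rfl fun t _ => ?_
        congr 2; ext i; push_cast; ring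
      · congr 2; ext i; rw [han]; push_cast; ring
    have hr : ∀ (t : ℕ) (F : G g → ℂ),
        powInt g p (fun x => rademacher g K x ^ t * F x) = powInt g p F := fun t F =>
      powInt_congr_norm fun x => by
        rw [norm_mul, norm_pow, norm_rademacher, one_pow, one_mul]
    have hmeas : ∀ (t : ℕ) (c : ℕ → ℂ) (A : ℕ),
        Measurable fun x => rademacher g K x ^ t * poly g c A x := fun t c A =>
      ((measurable_rademacher g K).pow_const t).mul (measurable_poly g c A)
    set P := (g.m K : ℝ) ^ (1 - p) with hP
    have hP0 : 0 ≤ P := by positivity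
    have h2 : ∀ t ∈ Finset.range a, powInt g p (fun x => rademacher g K x ^ t
            * poly g (fun i => (((n : ℂ) - (t * M g K : ℕ)) - i) * c (t * M g K + i)) (M g K) x)
        ≤ ENNReal.ofReal (((L : ℝ) ^ p + indexConst L p) * (M g K : ℝ) ^ p * P) * N := by
      intro t ht
      have ht' := Finset.mem_range.1 ht
      rw [hr]
      have h3 : ‖(n : ℂ) - (t * M g K : ℕ)‖ ≤ L * M g K := by
        have h4 : t * M g K ≤ n := by
          rw [han]; exact (Nat.mul_le_mul_right _ ht'.le).trans (Nat.le_add_right _ _)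
        rw [← Nat.cast_sub h4, Complex.norm_natCast]
        have h5 : (n : ℝ) ≤ M g (K + 1) := by exact_mod_cast hn.le
        have h6 : ((n - t * M g K : ℕ) : ℝ) ≤ n := by exact_mod_cast Nat.sub_le _ _
        exact (h6.trans h5).trans (M_succ_cast_le hL K)
      refine (powInt_sub_index_mul_le hL hp hp1 (fun i => c (t * M g K + i)) K h3).trans ?_
      refine (mul_le_mul' le_rfl (powInt_block_le hp hp1 c (ht'.trans ha))).trans (le_of_eq ?_)
      rw [← mul_assoc, ← ENNReal.ofReal_mul (by positivity),
        Real.mul_rpow (Nat.cast_nonneg _) hMK.le, hP, ← add_mul]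
    have h4 : powInt g p (fun x => rademacher g K x ^ a
          * poly g (fun i => ((n' : ℂ) - i) * c (a * M g K + i)) n' x)
        ≤ ENNReal.ofReal (L * ((L : ℝ) ^ p + indexConst L p) * (M g K : ℝ) ^ (1 - p)
          * digitSum g p K n' * P) * N := by
      rw [hr]
      refine (ih (fun i => c (a * M g K + i)) n' hn').trans ?_
      refine (mul_le_mul' le_rfl (powInt_block_le hp hp1 c ha)).trans (le_of_eq ?_)
      have := digitSum_nonneg g p K n'
      rw [← mul_assoc, ← ENNReal.ofReal_mul (by positivity)]
    rw [h1]
    refine (powInt_add_le hp hp1 (Finset.measurable_sum _ fun t _ => hmeas t _ _)).trans ?_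
    refine (add_le_add ((powInt_sum_le hp hp1 _ fun t => hmeas t _ _).trans
      (Finset.sum_le_sum h2)) h4).trans ?_
    have hS0 := digitSum_nonneg g p K n'
    rw [Finset.sum_const, Finset.card_range, nsmul_eq_mul, ← mul_assoc, ← add_mul,
      ← ENNReal.ofReal_natCast, ← ENNReal.ofReal_mul (Nat.cast_nonneg _),
      ← ENNReal.ofReal_add (by positivity) (by positivity)]
    refine mul_le_mul' (ENNReal.ofReal_le_ofReal ?_) le_rfl
    have hS : digitSum g p (K + 1) n
        = digitSum g p K n' + if a = 0 then 0 else (M g K : ℝ) ^ (2 * p - 1) := by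
      rw [digitSum, Finset.sum_range_succ, hdig, digitSum]
      congr 1
      exact Finset.sum_congr rfl fun j hj => by rw [digit_mod g n (Finset.mem_range.1 hj)]
    have hM : (M g (K + 1) : ℝ) ^ (1 - p) = P * (M g K : ℝ) ^ (1 - p) := by
      rw [M_succ, Nat.cast_mul, Real.mul_rpow hmK.le hMK.le]
    have h5 : (M g K : ℝ) ^ (1 - p) * (M g K : ℝ) ^ (2 * p - 1) = (M g K : ℝ) ^ p := by
      rw [← Real.rpow_add hMK]; congr 1; ring
    rw [hS, hM]
    -- For `a = 0` there are no complete blocks, which is why only nonzero digits enter `digitSum`.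
    have h6 : (a : ℝ) * (((L : ℝ) ^ p + indexConst L p) * (M g K : ℝ) ^ p * P)
        ≤ L * ((L : ℝ) ^ p + indexConst L p) * P * ((M g K : ℝ) ^ (1 - p)
          * if a = 0 then 0 else (M g K : ℝ) ^ (2 * p - 1)) := by
      split_ifs with h0
      · rw [h0]; simp
      · rw [h5]
        have h7 : (a : ℝ) ≤ L := by exact_mod_cast ha.le.trans (hL K)
        calc (a : ℝ) * (((L : ℝ) ^ p + indexConst L p) * (M g K : ℝ) ^ p * P)
            ≤ L * (((L : ℝ) ^ p + indexConst L p) * (M g K : ℝ) ^ p * P) := by gcongr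
          _ = _ := by ring
    linarith

/-- The sum starts at `lo g n`, and because `2 * p - 1 < 0` it is dominated by a geometric series
with its largest term there. -/
theorem digitSum_le (g : GenSeq) (hp2 : p < 1 / 2) (K : ℕ) {n : ℕ} :
    digitSum g p K n
      ≤ (M g (lo g n) : ℝ) ^ (-(1 - 2 * p)) * (2 ^ (1 - 2 * p) / (2 ^ (1 - 2 * p) - 1)) := by
  have hq : 0 < 1 - 2 * p := by linarith
  refine le_trans ?_ (sum_M_rpow_neg_le g hq (lo g n) K)
  have h0 : digitSum g p K n ≤ digitSum g p (lo g n + K) n :=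
    Finset.sum_le_sum_of_subset_of_nonneg (Finset.range_mono (by omega))
      fun j _ _ => by split_ifs <;> positivity
  refine h0.trans ?_
  rw [digitSum, Finset.sum_range_add, Finset.sum_eq_zero, zero_add]
  · refine Finset.sum_le_sum fun j _ => ?_
    split_ifs
    · positivity
    · rw [show -(1 - 2 * p) = 2 * p - 1 by ring]
  · intro j hj
    rw [if_pos]
    by_contra hc
    exact absurd (lo_le hc) (not_le.2 (Finset.mem_range.1 hj))

theorem rate_rpow (g : GenSeq) (hp : 0 < p) (n : ℕ) :
    rate g p n ^ p
      = (M g (hi g n) : ℝ) ^ (1 - 2 * p) * (M g (lo g n) : ℝ) ^ (-(1 - 2 * p)) := by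
  have h1 := M_cast_pos g (hi g n)
  have h2 := M_cast_pos g (lo g n)
  have h3 : (1 / p - 2) * p = 1 - 2 * p := by field_simp
  rw [rate, Real.div_rpow (by positivity) (by positivity), ← Real.rpow_mul h1.le,
    ← Real.rpow_mul h2.le, h3, Real.rpow_neg h2.le, div_eq_mul_inv]

theorem rate_pos (g : GenSeq) (p : ℝ) (n : ℕ) : 0 < rate g p n := by
  have h1 := M_cast_pos g (hi g n)
  have h2 := M_cast_pos g (lo g n)
  unfold rate; positivity

theorem two_lt_one_div (hp : 0 < p) (hp2 : p < 1 / 2) : 0 < 1 / p - 2 := by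
  rw [sub_pos, lt_div_iff₀ hp]; linarith

theorem one_le_rate (g : GenSeq) (hp : 0 < p) (hp2 : p < 1 / 2) {n : ℕ} (hn : 1 ≤ n) :
    1 ≤ rate g p n := by
  have h1 := M_cast_pos g (lo g n)
  rw [rate, one_le_div (by positivity)]
  refine Real.rpow_le_rpow h1.le ?_ (two_lt_one_div hp hp2).le
  exact_mod_cast M_mono g (lo_le_hi g hn)

/-- The `p`-th power of the norm constant of the Fejér means. -/
noncomputable def fejerConst (L : ℕ) (p : ℝ) : ℝ :=
  1 + (1 + indexConst L p) * ((L : ℝ) ^ p / (2 ^ p - 1))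
    + L * ((L : ℝ) ^ p + indexConst L p) * L * (2 ^ (1 - 2 * p) / (2 ^ (1 - 2 * p) - 1))

theorem fejerConst_pos (L : ℕ) (hp : 0 < p) (hp2 : p < 1 / 2) : 0 < fejerConst L p := by
  have h1 := indexConst_nonneg L hp
  have h2 := two_rpow_sub_one_pos hp
  have h3 := two_rpow_sub_one_pos (q := 1 - 2 * p) (by linarith)
  unfold fejerConst; positivity

theorem measurable_maximal {f : ℕ → G g → ℂ} (hf : ∀ n, Measurable (f n)) :
    Measurable (maximal g f) :=
  Measurable.iSup fun n => (hf n).enorm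

theorem lintegral_maximal_fejer_le {L : ℕ} (hL : ∀ k, g.m k ≤ L) (hp : 0 < p) (hp2 : p < 1 / 2)
    {f : ℕ → G g → ℂ} (hf : Martingale f (filt g) (haar g)) {n : ℕ} (hn : 1 ≤ n) :
    ∫⁻ x, maximal g (regular g (fejer g f n)) x ^ p ∂(haar g)
      ≤ ENNReal.ofReal (fejerConst L p * rate g p n ^ p)
        * ∫⁻ x, maximal g f x ^ p ∂(haar g) := by
  have hp1 : p ≤ 1 := by linarith
  have hC := indexConst_nonneg L hp
  have hfp := martingale_eq_poly hf
  set c := coeff g f with hc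
  set N := hi g n with hN
  set H := ∫⁻ x, maximal g f x ^ p ∂(haar g) with hH
  have hn0 : (0 : ℝ) < n := by exact_mod_cast hn
  have hMN : (M g N : ℝ) ≤ n := by exact_mod_cast M_hi_le g hn
  have hMN1 : (M g (N + 1) : ℝ) ≤ L * M g N := M_succ_cast_le hL N
  have hfH : ∀ k, powInt g p (f k) ≤ H := fun k =>
    lintegral_mono fun x => ENNReal.rpow_le_rpow (le_iSup (fun n => ‖f n x‖ₑ) k) hp.le
  set V : ℕ → G g → ℂ := fun k x =>
    (1 / (n : ℂ)) * poly g (fun i => ((M g k : ℂ) - i) * c i) (M g k) x with hV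
  set U : G g → ℂ := fun x => (1 / (n : ℂ)) * poly g (fun i => ((n : ℂ) - i) * c i) n x with hU
  have hVm : ∀ k, Measurable (V k) := fun k => (measurable_poly g _ _).const_mul _
  have hfm : ∀ k, Measurable (f k) := fun k => by rw [hfp k]; exact measurable_poly g _ _
  have hpt : ∀ k x, ‖poly g (fun i => (1 / (n : ℂ)) * (((n : ℂ) - i) * c i)) (min n (M g k)) x‖ₑ ^ p
      ≤ maximal g f x ^ p + ∑ k ∈ Finset.range (N + 1), ‖V k x‖ₑ ^ p + ‖U x‖ₑ ^ p := by
    intro k x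
    rcases lt_or_ge N k with hk | hk
    · have h1 : n ≤ M g k := (lt_M_hi_succ g n).le.trans (M_mono g hk)
      rw [min_eq_left h1]
      have h2 : poly g (fun i => (1 / (n : ℂ)) * (((n : ℂ) - i) * c i)) n x = U x := by
        simp only [hU, poly, Finset.mul_sum]
        exact Finset.sum_congr rfl fun i _ => by ring
      rw [h2]
      exact le_add_self
    · have h1 : M g k ≤ n := (M_mono g hk).trans (M_hi_le g hn)
      rw [min_eq_right h1]
      -- From `n - i = (n - M_k) + (M_k - i)`: the first part is `f k` times a factor in `[0, 1]`,
      -- absorbed by the maximal function. The remainder `V k` has `p`-integral of order `(M_k /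
      -- n)^p`, which is summable over `k ≤ N`.
      have h2 : poly g (fun i => (1 / (n : ℂ)) * (((n : ℂ) - i) * c i)) (M g k) x
          = (((n : ℂ) - M g k) / n) * f k x + V k x := by
        rw [hfp k]
        simp only [hV, poly, Finset.mul_sum]
        rw [← Finset.sum_add_distrib]
        exact Finset.sum_congr rfl fun i _ => by ring
      rw [h2]
      refine (enorm_add_rpow_le hp hp1 _ _).trans (le_add_right (add_le_add ?_ ?_))
      · refine ENNReal.rpow_le_rpow ?_ hp.le
        refine le_trans ?_ (le_iSup (fun n => ‖f n x‖ₑ) k)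
        rw [enorm_mul]
        refine mul_le_of_le_one_left' ?_
        rw [← ofReal_norm, ENNReal.ofReal_le_one, ← Nat.cast_sub h1, norm_div,
          Complex.norm_natCast, Complex.norm_natCast, div_le_one hn0]
        exact_mod_cast Nat.sub_le _ _
      · exact Finset.single_le_sum (f := fun k => ‖V k x‖ₑ ^ p) (fun _ _ => zero_le)
          (Finset.mem_range.2 (Nat.lt_succ_of_le hk))
  have hae : ∀ᵐ x ∂(haar g), maximal g (regular g (fejer g f n)) x ^ p
      ≤ maximal g f x ^ p + ∑ k ∈ Finset.range (N + 1), ‖V k x‖ₑ ^ p + ‖U x‖ₑ ^ p := by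
    have h1 : ∀ᵐ x ∂(haar g), ∀ k, regular g (fejer g f n) k x
        = poly g (fun i => (1 / (n : ℂ)) * (((n : ℂ) - i) * c i)) (min n (M g k)) x := by
      refine ae_all_iff.2 fun k => ?_
      have := condExp_poly g (fun i => (1 / (n : ℂ)) * (((n : ℂ) - i) * c i)) n k
      rw [regular, fejer_eq_poly]
      exact this
    filter_upwards [h1] with x hx
    rw [← ENNReal.le_rpow_inv_iff hp, maximal]
    refine iSup_le fun k => ?_
    rw [ENNReal.le_rpow_inv_iff hp, hx k]
    exact hpt k x
  have hVb : ∀ k, powInt g p (V k)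
      ≤ ENNReal.ofReal ((1 + indexConst L p) * (M g k : ℝ) ^ p / (n : ℝ) ^ p) * H := by
    intro k
    have h1 := powInt_sub_index_mul_le hL hp hp1 c k (a := (M g k : ℂ)) (A := M g k)
      (by rw [Complex.norm_natCast])
    rw [hV, powInt_const_mul hp _ (measurable_poly g _ _)]
    refine (mul_le_mul' le_rfl (h1.trans (mul_le_mul' le_rfl (hfp k ▸ hfH k)))).trans (le_of_eq ?_)
    rw [← mul_assoc, ← ENNReal.ofReal_mul (by positivity), norm_div, norm_one,
      Complex.norm_natCast, Real.div_rpow zero_le_one hn0.le, Real.one_rpow]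
    congr 2; ring
  have hUb : powInt g p U ≤ ENNReal.ofReal (L * ((L : ℝ) ^ p + indexConst L p)
      * (M g (N + 1) : ℝ) ^ (1 - p) * digitSum g p (N + 1) n / (n : ℝ) ^ p) * H := by
    have h1 := powInt_fejer_sum_le hL hp hp1 (N + 1) c n (lt_M_hi_succ g n)
    have h2 := digitSum_nonneg g p (N + 1) n
    rw [hU, powInt_const_mul hp _ (measurable_poly g _ _)]
    refine (mul_le_mul' le_rfl
      (h1.trans (mul_le_mul' le_rfl (hfp (N + 1) ▸ hfH (N + 1))))).trans (le_of_eq ?_)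
    rw [← mul_assoc, ← ENNReal.ofReal_mul (by positivity), norm_div, norm_one,
      Complex.norm_natCast, Real.div_rpow zero_le_one hn0.le, Real.one_rpow]
    congr 2; ring
  refine (lintegral_mono_ae hae).trans ?_
  have hm1 : Measurable fun x => maximal g f x ^ p := (measurable_maximal hfm).pow_const p
  have hm2 : Measurable fun x => ∑ k ∈ Finset.range (N + 1), ‖V k x‖ₑ ^ p :=
    Finset.measurable_sum _ fun k _ => (hVm k).enorm.pow_const p
  have hm3 : Measurable fun x => maximal g f x ^ p + ∑ k ∈ Finset.range (N + 1), ‖V k x‖ₑ ^ p :=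
    hm1.add hm2
  rw [lintegral_add_left hm3, lintegral_add_left hm1,
    lintegral_finsetSum _ fun k _ => (hVm k).enorm.pow_const p]
  refine (add_le_add (add_le_add le_rfl (Finset.sum_le_sum fun k _ => hVb k)) hUb).trans ?_
  have hD := digitSum_nonneg g p (N + 1) n
  rw [← Finset.sum_mul, ← ENNReal.ofReal_sum_of_nonneg (fun k _ => by positivity)]
  have hH1 : H = ENNReal.ofReal 1 * H := by rw [ENNReal.ofReal_one, one_mul]
  rw [← hH]
  conv_lhs => enter [1, 1]; rw [hH1]
  rw [← add_mul, ← add_mul,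
    ← ENNReal.ofReal_add zero_le_one (Finset.sum_nonneg fun k _ => by positivity),
    ← ENNReal.ofReal_add (add_nonneg zero_le_one (Finset.sum_nonneg fun k _ => by positivity))
      (by positivity)]
  refine mul_le_mul' (ENNReal.ofReal_le_ofReal ?_) le_rfl
  have hr1 : 1 ≤ rate g p n ^ p := Real.one_le_rpow (one_le_rate g hp hp2 hn) hp.le
  have h2p := two_rpow_sub_one_pos hp
  have hMN0 := M_cast_pos g N
  have e1 : ∑ k ∈ Finset.range (N + 1), (1 + indexConst L p) * (M g k : ℝ) ^ p / (n : ℝ) ^ p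
      ≤ (1 + indexConst L p) * ((L : ℝ) ^ p / (2 ^ p - 1)) := by
    rw [← Finset.sum_div, ← Finset.mul_sum, mul_div_assoc]
    refine mul_le_mul_of_nonneg_left ?_ (by positivity)
    rw [div_le_iff₀ (by positivity)]
    refine (sum_M_rpow_le g hp (N + 1)).trans ?_
    rw [div_mul_eq_mul_div, ← Real.mul_rpow (Nat.cast_nonneg _) hn0.le]
    gcongr
    exact hMN1.trans (by gcongr)
  have e2 : L * ((L : ℝ) ^ p + indexConst L p)
      * (M g (N + 1) : ℝ) ^ (1 - p) * digitSum g p (N + 1) n / (n : ℝ) ^ p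
      ≤ L * ((L : ℝ) ^ p + indexConst L p) * L * (2 ^ (1 - 2 * p) / (2 ^ (1 - 2 * p) - 1))
        * rate g p n ^ p := by
    rw [rate_rpow g hp, ← hN]
    have hb : (M g (N + 1) : ℝ) ^ (1 - p) ≤ L * (M g N : ℝ) ^ (1 - p) := by
      rw [M_succ, Nat.cast_mul, Real.mul_rpow (Nat.cast_nonneg _) hMN0.le]
      gcongr
      exact nat_rpow_one_sub_le (m_pos g N) (hL N) hp
    have hd := digitSum_le g hp2 (N + 1) (n := n)
    have hnp : (M g N : ℝ) ^ p ≤ (n : ℝ) ^ p := by gcongr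
    have hs : (M g N : ℝ) ^ (1 - p) / (M g N : ℝ) ^ p = (M g N : ℝ) ^ (1 - 2 * p) := by
      rw [← Real.rpow_sub hMN0]; congr 1; ring
    have h3 := two_rpow_sub_one_pos (q := 1 - 2 * p) (by linarith)
    calc _ ≤ L * ((L : ℝ) ^ p + indexConst L p) * (L * (M g N : ℝ) ^ (1 - p))
          * ((M g (lo g n) : ℝ) ^ (-(1 - 2 * p)) * (2 ^ (1 - 2 * p) / (2 ^ (1 - 2 * p) - 1)))
          / (M g N : ℝ) ^ p := by gcongr
      _ = L * ((L : ℝ) ^ p + indexConst L p) * L * (2 ^ (1 - 2 * p) / (2 ^ (1 - 2 * p) - 1))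
          * ((M g N : ℝ) ^ (1 - p) / (M g N : ℝ) ^ p * (M g (lo g n) : ℝ) ^ (-(1 - 2 * p))) := by
          ring
      _ = _ := by rw [hs]
  have e3 : 0 ≤ 1 + (1 + indexConst L p) * ((L : ℝ) ^ p / (2 ^ p - 1)) := by positivity
  unfold fejerConst
  nlinarith

theorem hardyNorm_fejer_le {L : ℕ} (hL : ∀ k, g.m k ≤ L) (hp : 0 < p) (hp2 : p < 1 / 2)
    {f : ℕ → G g → ℂ} (hf : Martingale f (filt g) (haar g)) {n : ℕ} (hn : 1 ≤ n) :
    hardyNorm g p (regular g (fejer g f n))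
      ≤ ENNReal.ofReal (fejerConst L p ^ (1 / p) * rate g p n) * hardyNorm g p f := by
  have hC := fejerConst_pos L hp hp2
  have hr := rate_pos g p n
  have h1 : fejerConst L p ^ (1 / p) * rate g p n = (fejerConst L p * rate g p n ^ p) ^ (1 / p) := by
    rw [Real.mul_rpow hC.le (by positivity), ← Real.rpow_mul hr.le, mul_one_div_cancel hp.ne',
      Real.rpow_one]
  rw [hardyNorm, hardyNorm, h1, ← ENNReal.ofReal_rpow_of_nonneg (by positivity) (by positivity),
    ← ENNReal.mul_rpow_of_nonneg _ _ (by positivity)]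
  exact ENNReal.rpow_le_rpow (lintegral_maximal_fejer_le hL hp hp2 hf hn) (by positivity)

end

section

variable {g : GenSeq}

/-! ### Pointwise lower estimates of Fejér kernels -/

theorem sub_one_mul_sum_mul_pow (r : ℂ) (k : ℕ) :
    (r - 1) * ∑ t ∈ Finset.range k, (t : ℂ) * r ^ t
      = k * r ^ k - r * ∑ t ∈ Finset.range k, r ^ t := by
  induction k with
  | zero => simp
  | succ k ih =>
    rw [Finset.sum_range_succ, mul_add, ih, Finset.sum_range_succ]
    push_cast; ring

theorem sub_one_mul_sum_sub_mul_pow (r : ℂ) (a : ℕ) :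
    (r - 1) * ∑ t ∈ Finset.range a, ((a : ℂ) - t) * r ^ t
      = ∑ t ∈ Finset.range a, r ^ (t + 1) - a := by
  have h1 := sub_one_mul_sum_mul_pow r a
  have h2 := mul_geom_sum r a
  have h3 : ∑ t ∈ Finset.range a, ((a : ℂ) - t) * r ^ t
      = a * ∑ t ∈ Finset.range a, r ^ t - ∑ t ∈ Finset.range a, (t : ℂ) * r ^ t := by
    rw [Finset.mul_sum, ← Finset.sum_sub_distrib]
    exact Finset.sum_congr rfl fun t _ => sub_mul _ _ _
  have h4 : ∑ t ∈ Finset.range a, r ^ (t + 1) = r * ∑ t ∈ Finset.range a, r ^ t := by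
    rw [Finset.mul_sum]
    exact Finset.sum_congr rfl fun t _ => pow_succ' _ _
  rw [h3, h4]
  linear_combination (a : ℂ) * h2 - h1

theorem sub_one_mul_sum_mul_pow_of_root {r : ℂ} {m : ℕ} (hr : r ^ m = 1) (hr1 : r ≠ 1) :
    (r - 1) * ∑ t ∈ Finset.range m, (t : ℂ) * r ^ t = m := by
  rw [sub_one_mul_sum_mul_pow, geom_sum_eq hr1, hr]; simp

theorem norm_eq_one_of_root {r : ℂ} {m : ℕ} (hm : 1 ≤ m) (hr : r ^ m = 1) : ‖r‖ = 1 :=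
  Complex.norm_eq_one_of_pow_eq_one hr (by omega)

theorem norm_sub_one_le_two {r : ℂ} (hr : ‖r‖ = 1) : ‖r - 1‖ ≤ 2 := by
  calc ‖r - 1‖ ≤ ‖r‖ + ‖(1 : ℂ)‖ := norm_sub_le _ _
    _ = 2 := by rw [hr, norm_one]; norm_num

/-- In `(r - 1) ∑ t r^t = m` the sum has modulus at most `m^2`. This algebraic bound replaces
trigonometric estimates. -/
theorem inv_le_norm_sub_one_of_root {r : ℂ} {m : ℕ} (hm : 1 ≤ m) (hr : r ^ m = 1) (hr1 : r ≠ 1) :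
    (m : ℝ)⁻¹ ≤ ‖r - 1‖ := by
  have h0 : (0 : ℝ) < m := by exact_mod_cast hm
  have h1 := congrArg norm (sub_one_mul_sum_mul_pow_of_root hr hr1)
  rw [norm_mul, Complex.norm_natCast] at h1
  have h2 : ‖∑ t ∈ Finset.range m, (t : ℂ) * r ^ t‖ ≤ m * m := by
    refine (norm_sum_le_of_le _ (f := fun t : ℕ => (t : ℂ) * r ^ t) (n := fun _ => (m : ℝ))
      fun t ht => ?_).trans ?_
    · rw [norm_mul, norm_pow, norm_eq_one_of_root hm hr, one_pow, mul_one, Complex.norm_natCast]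
      exact_mod_cast (Finset.mem_range.1 ht).le
    · simp
  rw [inv_le_iff_one_le_mul₀' h0]
  have h3 : (m : ℝ) ≤ ‖r - 1‖ * (m * m) := by
    calc (m : ℝ) = _ := h1.symm
      _ ≤ _ := by gcongr
  nlinarith

theorem one_le_norm_sum_mul_pow_of_root {r : ℂ} {m : ℕ} (hm : 2 ≤ m) (hr : r ^ m = 1)
    (hr1 : r ≠ 1) : 1 ≤ ‖∑ t ∈ Finset.range m, (t : ℂ) * r ^ t‖ := by
  have h1 := congrArg norm (sub_one_mul_sum_mul_pow_of_root hr hr1)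
  rw [norm_mul, Complex.norm_natCast] at h1
  have h2 := norm_sub_one_le_two (norm_eq_one_of_root (by omega) hr)
  have h3 : (2 : ℝ) ≤ m := by exact_mod_cast hm
  have h4 := norm_nonneg (∑ t ∈ Finset.range m, (t : ℂ) * r ^ t)
  nlinarith

/-- The sum `∑_{i<n} (n-i) ψ_i`, that is, `n` times the Fejér kernel. -/
noncomputable def fejerSum (g : GenSeq) (n : ℕ) (x : G g) : ℂ :=
  ∑ i ∈ Finset.range n, ((n : ℂ) - i) * psi g i x

/-- The sum `∑_{i<M_K} i ψ_i`. -/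
noncomputable def indexSum (g : GenSeq) (K : ℕ) (x : G g) : ℂ :=
  ∑ i ∈ Finset.range (M g K), (i : ℂ) * psi g i x

theorem dirichlet_mul_add {K a n : ℕ} (ha : a < g.m K) (hn : n ≤ M g K) (x : G g) :
    dirichlet g (a * M g K + n) x
      = (∑ t ∈ Finset.range a, rademacher g K x ^ t) * dirichlet g (M g K) x
        + rademacher g K x ^ a * dirichlet g n x := by
  have h := poly_mul_add (g := g) (fun _ => 1) ha hn x
  simp_rw [poly, one_mul] at h
  rw [Finset.sum_mul]; exact h

theorem fejerSum_mul_add {K a n : ℕ} (ha : a < g.m K) (hn : n ≤ M g K) (x : G g) :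
    fejerSum g (a * M g K + n) x
      = ∑ t ∈ Finset.range a, rademacher g K x ^ t
          * ((((a * M g K + n : ℕ) : ℂ) - t * M g K) * dirichlet g (M g K) x - indexSum g K x)
        + rademacher g K x ^ a * fejerSum g n x := by
  have h := poly_mul_add (g := g) (fun i => ((a * M g K + n : ℕ) : ℂ) - i) ha hn x
  simp_rw [poly] at h
  rw [fejerSum, h]
  congr 1
  · refine Finset.sum_congr rfl fun t _ => ?_
    congr 1
    rw [dirichlet, indexSum, Finset.mul_sum, ← Finset.sum_sub_distrib]
    refine Finset.sum_congr rfl fun i _ => ?_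
    push_cast; ring
  · congr 1
    refine Finset.sum_congr rfl fun i _ => ?_
    push_cast; ring

theorem indexSum_succ (K : ℕ) (x : G g) :
    indexSum g (K + 1) x
      = (∑ t ∈ Finset.range (g.m K), (t : ℂ) * rademacher g K x ^ t)
          * (M g K * dirichlet g (M g K) x)
        + (∑ t ∈ Finset.range (g.m K), rademacher g K x ^ t) * indexSum g K x := by
  rw [indexSum, sum_range_M_succ, Finset.sum_mul, Finset.sum_mul, ← Finset.sum_add_distrib]
  refine Finset.sum_congr rfl fun t ht => ?_
  rw [dirichlet, indexSum]
  simp_rw [Finset.mul_sum]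
  rw [← Finset.sum_add_distrib]
  refine Finset.sum_congr rfl fun i hi => ?_
  rw [psi_mul_add (Finset.mem_range.1 ht) (Finset.mem_range.1 hi)]
  push_cast; ring

theorem dirichlet_M_eq_zero {j K : ℕ} (hj : j < K) {x : G g} (hx : x j ≠ 0) :
    dirichlet g (M g K) x = 0 := by
  rw [dirichlet_M, Set.indicator_of_notMem]
  exact fun h => hx (h j hj)

/-- In the recursion `indexSum_succ`, the coordinate `x i ≠ 0` kills every Dirichlet kernel from
level `j` on, and `x j ≠ 0` kills the geometric sum at level `j`; after that nothing nonzero is left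
to propagate. -/
theorem indexSum_eq_zero {i j : ℕ} (hij : i < j) {x : G g} (hi : x i ≠ 0) (hj : x j ≠ 0)
    {K : ℕ} (hK : j + 1 ≤ K) : indexSum g K x = 0 := by
  induction K, hK using Nat.le_induction with
  | base =>
    rw [indexSum_succ, dirichlet_M_eq_zero hij hi, sum_rademacher_pow, if_neg hj]; ring
  | succ K hK ih =>
    rw [indexSum_succ, dirichlet_M_eq_zero (by omega : i < K) hi, ih]; ring

theorem norm_dirichlet_mod {J : ℕ} {x : G g} (hD : ∀ K, J ≤ K → dirichlet g (M g K) x = 0)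
    (n : ℕ) : ‖dirichlet g n x‖ = ‖dirichlet g (n % M g J) x‖ := by
  have key : ∀ K, J ≤ K → ∀ n < M g K, ‖dirichlet g n x‖ = ‖dirichlet g (n % M g J) x‖ := by
    intro K hK
    induction K, hK using Nat.le_induction with
    | base => intro n hn; rw [Nat.mod_eq_of_lt hn]
    | succ K hK ih =>
      intro n hn
      have hn' := Nat.mod_lt n (M_pos g K)
      have ha : n / M g K < g.m K := by
        rw [Nat.div_lt_iff_lt_mul (M_pos g K), ← M_succ]; exact hn
      have h := dirichlet_mul_add ha hn'.le x
      rw [mul_comm (n / M g K), Nat.div_add_mod, hD K hK, mul_zero, zero_add] at h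
      rw [h, norm_mul, norm_pow, norm_rademacher, one_pow, one_mul, ih _ hn',
        Nat.mod_mod_of_dvd _ (M_dvd_M g hK)]
  exact key (max J n) (le_max_left _ _) n
    ((lt_M_self g n).trans_le (M_mono g (le_max_right _ _)))

/-- Where the kernels vanish from level `J` on, complete blocks contribute nothing and each higher
digit only multiplies by a power of a Rademacher function, which is unimodular. -/
theorem norm_fejerSum_mod {J : ℕ} {x : G g} (hD : ∀ K, J ≤ K → dirichlet g (M g K) x = 0)
    (hE : ∀ K, J ≤ K → indexSum g K x = 0) (n : ℕ) :
    ‖fejerSum g n x‖ = ‖fejerSum g (n % M g J) x‖ := by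
  have key : ∀ K, J ≤ K → ∀ n < M g K, ‖fejerSum g n x‖ = ‖fejerSum g (n % M g J) x‖ := by
    intro K hK
    induction K, hK using Nat.le_induction with
    | base => intro n hn; rw [Nat.mod_eq_of_lt hn]
    | succ K hK ih =>
      intro n hn
      have hn' := Nat.mod_lt n (M_pos g K)
      have ha : n / M g K < g.m K := by
        rw [Nat.div_lt_iff_lt_mul (M_pos g K), ← M_succ]; exact hn
      have h := fejerSum_mul_add ha hn'.le x
      rw [mul_comm (n / M g K), Nat.div_add_mod, hD K hK, hE K hK] at h
      simp only [mul_zero, sub_zero, Finset.sum_const_zero, zero_add] at h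
      rw [h, norm_mul, norm_pow, norm_rademacher, one_pow, one_mul, ih _ hn',
        Nat.mod_mod_of_dvd _ (M_dvd_M g hK)]
  exact key (max J n) (le_max_left _ _) n
    ((lt_M_self g n).trans_le (M_mono g (le_max_right _ _)))

theorem mod_M_succ (n K : ℕ) : n % M g (K + 1) = digit g n K * M g K + n % M g K := by
  rw [M_succ, mul_comm (g.m K), Nat.mod_mul, digit]; ring

/-- The point whose coordinates with indices `s` and `s + 1` are one, the other ones zero. -/
def twoOnes (g : GenSeq) (s : ℕ) : G g := fun k => if k = s ∨ k = s + 1 then 1 else 0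

theorem one_ne_zero_zmod (g : GenSeq) (k : ℕ) : (1 : ZMod (g.m k)) ≠ 0 := by
  have := g.two_le k
  have : Fact (1 < g.m k) := ⟨by omega⟩
  exact one_ne_zero

/-- The two nonzero coordinates reduce `n` to `a M_{s+1}`, with `a` its lowest nonzero digit. What
remains is the product of `∑_{t<a} r^t`, `∑ t r_s^t` and `M_s^2`, up to sign. The first sum is at
least `1 / (2L)` since `r^a ≠ 1` at a coordinate equal to one, the second is at least `1`, and `M_s
≥ M_{s+1} / L`. -/
theorem norm_fejerSum_twoOnes_ge {L : ℕ} (hL : ∀ k, g.m k ≤ L) {n s : ℕ} (hs : lo g n = s + 1)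
    (hn : 1 ≤ n) {x : G g} (hx : x ∈ interval g (s + 2) (twoOnes g s)) :
    (M g (s + 1) : ℝ) ^ 2 / (2 * (L : ℝ) ^ 3) ≤ ‖fejerSum g n x‖ := by
  have hx0 : x s = 1 := by rw [hx s (by omega)]; simp [twoOnes]
  have hx1 : x (s + 1) = 1 := by rw [hx (s + 1) (by omega)]; simp [twoOnes]
  have hxs : x s ≠ 0 := by rw [hx0]; exact one_ne_zero_zmod g s
  have hxs1 : x (s + 1) ≠ 0 := by rw [hx1]; exact one_ne_zero_zmod g (s + 1)
  have hlow : x ∈ interval g s 0 := fun k hk => by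
    rw [hx k (by omega), twoOnes, if_neg (by omega)]; rfl
  have hL0 : (0 : ℝ) < L := by exact_mod_cast (m_pos g 0).trans_le (hL 0)
  rw [norm_fejerSum_mod (J := s + 2)
    (fun K hK => dirichlet_M_eq_zero (by omega : s < K) hxs)
    (fun K hK => indexSum_eq_zero (Nat.lt_succ_self s) hxs hxs1 hK), mod_M_succ,
    ← hs, mod_M_lo, hs]
  set a := digit g n (s + 1) with ha
  have ha0 : a ≠ 0 := by rw [ha, ← hs]; exact digit_lo_ne_zero g hn
  have ham : a < g.m (s + 1) := digit_lt g n (s + 1)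
  rw [fejerSum_mul_add ham (Nat.zero_le _), dirichlet_M_eq_zero (Nat.lt_succ_self s) hxs]
  have hE : indexSum g (s + 1) x
      = (∑ t ∈ Finset.range (g.m s), (t : ℂ) * rademacher g s x ^ t) * (M g s * M g s) := by
    rw [indexSum_succ, sum_rademacher_pow, if_neg hxs, dirichlet_M, Set.indicator_of_mem hlow]
    ring
  have hz : fejerSum g 0 x = 0 := by simp [fejerSum]
  simp_rw [hz, mul_zero, zero_sub, add_zero, ← Finset.sum_mul]
  rw [norm_mul, norm_neg, hE, norm_mul, norm_mul, Complex.norm_natCast]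
  have h1 := one_le_norm_sum_mul_pow_of_root (g.two_le s) (rademacher_pow_m g s x)
    (fun h => hxs (rademacher_eq_one_iff.1 h))
  set r := rademacher g (s + 1) x with hr
  have hr1 : r ≠ 1 := fun h => hxs1 (rademacher_eq_one_iff.1 h)
  have hra : r ^ a ≠ 1 := by
    have := stdAddChar_pow_ne ham (m_pos g (s + 1)) ha0
    rwa [pow_zero, ← hx1, ← rademacher_eq] at this
  have h2 : (2 * L : ℝ)⁻¹ ≤ ‖∑ t ∈ Finset.range a, r ^ t‖ := by
    have h3 := inv_le_norm_sub_one_of_root (m_pos g (s + 1))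
      (by rw [← pow_mul, mul_comm, pow_mul, rademacher_pow_m, one_pow]) hra
    have h4 : (L : ℝ)⁻¹ ≤ (g.m (s + 1) : ℝ)⁻¹ := by
      have h5 : (0 : ℝ) < g.m (s + 1) := by exact_mod_cast m_pos g (s + 1)
      gcongr
      exact hL (s + 1)
    have h5 := congrArg norm (mul_geom_sum r a)
    rw [norm_mul] at h5
    have h6 := norm_sub_one_le_two (norm_rademacher g (s + 1) x)
    rw [mul_inv]
    have h7 := norm_nonneg (∑ t ∈ Finset.range a, r ^ t)
    nlinarith
  have h3 : (M g (s + 1) : ℝ) ^ 2 ≤ (L : ℝ) ^ 2 * (M g s * M g s) := by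
    have := M_succ_cast_le hL s
    calc (M g (s + 1) : ℝ) ^ 2 ≤ (L * M g s) ^ 2 := by gcongr
      _ = _ := by ring
  have h4 := M_cast_pos g s
  calc (M g (s + 1) : ℝ) ^ 2 / (2 * (L : ℝ) ^ 3)
      ≤ (L : ℝ) ^ 2 * (M g s * M g s) / (2 * (L : ℝ) ^ 3) := by gcongr
    _ = (2 * L : ℝ)⁻¹ * (1 * (M g s * M g s)) := by field_simp
    _ ≤ _ := by gcongr

/-! ### Kernel lower bounds when the zeroth digit of `n` is nonzero -/

theorem fejerSum_eq_sub_dirichlet (n : ℕ) (x : G g) :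
    fejerSum g n x = fejerSum g (n + 1) x - dirichlet g (n + 1) x := by
  rw [fejerSum, fejerSum, dirichlet, Finset.sum_range_succ, Finset.sum_range_succ]
  have : ∑ i ∈ Finset.range n, ((n : ℂ) - i) * psi g i x
      = ∑ i ∈ Finset.range n, (((n + 1 : ℕ) : ℂ) - i) * psi g i x
        - ∑ i ∈ Finset.range n, psi g i x := by
    rw [← Finset.sum_sub_distrib]
    exact Finset.sum_congr rfl fun i _ => by push_cast; ring
  rw [this]; push_cast; ring

theorem fejerSum_congr {n K : ℕ} (hn : n ≤ M g K) {x y : G g} (hxy : ∀ k < K, y k = x k) :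
    fejerSum g n y = fejerSum g n x :=
  poly_congr_coord (fun i => (n : ℂ) - i) hn x y hxy

/-- Otherwise the sum minus `κ` would be supported at `z = 0`, so all its Fourier coefficients would
agree; but those at the frequencies `1` and `N - 1` are `N` and `0`, because `1 ≤ a < N - 1`. -/
theorem exists_sum_stdAddChar_pow_ne {N a : ℕ} [NeZero N] (ha : 1 ≤ a) (haN : a + 1 < N) (κ : ℂ) :
    ∃ z : ZMod N, z ≠ 0 ∧ ∑ t ∈ Finset.range a, (ZMod.stdAddChar z : ℂ) ^ (t + 1) ≠ κ := by
  by_contra! hc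
  -- The second factor vanishes at `z = 0`, the only point where the first may be nonzero.
  have h1 : ∑ z : ZMod N, (∑ t ∈ Finset.range a, (ZMod.stdAddChar z : ℂ) ^ (t + 1) - κ)
      * (conj (ZMod.stdAddChar z : ℂ) ^ 1 - conj (ZMod.stdAddChar z : ℂ) ^ (N - 1)) = 0 := by
    refine Finset.sum_eq_zero fun z _ => ?_
    by_cases hz : z = 0
    · rw [hz, AddChar.map_zero_eq_one]; simp
    · rw [hc z hz, sub_self, zero_mul]
  have h2 : ∀ b, b < N → b ≠ 0 →
      ∑ z : ZMod N, (∑ t ∈ Finset.range a, (ZMod.stdAddChar z : ℂ) ^ (t + 1) - κ)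
        * conj (ZMod.stdAddChar z : ℂ) ^ b = if b - 1 < a then (N : ℂ) else 0 := by
    intro b hb hb0
    have h3 := sum_stdAddChar_pow_mul (N := N) (a := 0) (b := b) (by omega) hb
    simp_rw [pow_zero, one_mul] at h3
    simp_rw [sub_mul, Finset.sum_sub_distrib, Finset.sum_mul]
    rw [← Finset.mul_sum, h3, if_neg hb0.symm, mul_zero, sub_zero, Finset.sum_comm]
    rw [Finset.sum_congr rfl fun t ht => sum_stdAddChar_pow_mul (N := N) (a := t + 1) (b := b)
      (by have := Finset.mem_range.1 ht; omega) hb]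
    split_ifs with h
    · rw [Finset.sum_eq_single (b - 1)]
      · rw [if_pos (by omega)]
      · intro t _ ht; rw [if_neg (by omega)]
      · intro hn; exact absurd (Finset.mem_range.2 h) hn
    · refine Finset.sum_eq_zero fun t ht => ?_
      have := Finset.mem_range.1 ht
      rw [if_neg (by omega)]
  simp_rw [mul_sub, Finset.sum_sub_distrib] at h1
  rw [h2 1 (by omega) one_ne_zero, h2 (N - 1) (by omega) (by omega), if_pos (by omega),
    if_neg (by omega), sub_zero] at h1
  exact (NeZero.ne N) (by exact_mod_cast h1)

theorem exists_fejerSum_ne_zero {n : ℕ} (hn : n < M g 2) (h0 : digit g n 0 ≠ 0)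
    (h1 : digit g n 0 + 1 < g.m 0) :
    ∃ v : G g, v 0 ≠ 0 ∧ v 1 ≠ 0 ∧ fejerSum g n v ≠ 0 := by
  set a := digit g n 0 with ha
  set b := digit g n 1 with hb
  have hn1 : n % M g 1 = a := by
    rw [mod_M_succ, M_zero, Nat.mod_one, mul_one, add_zero]
  have hnab : n = b * M g 1 + a := by
    rw [← Nat.mod_eq_of_lt hn, mod_M_succ, hn1]
  have hb1 : b < g.m 1 := digit_lt g n 1
  set w : ℂ := ZMod.stdAddChar (1 : ZMod (g.m 1)) with hw
  have hw0 : w ≠ 0 := by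
    rw [hw, ZMod.stdAddChar_apply]; exact Circle.coe_ne_zero _
  -- Multiplied by `r - 1`, the equation `fejerSum g n v = 0` reads `w^b (∑ r^(t+1) - a) = m_0
  -- ∑_{t<b} w^t`. The excluded value is its solution for `∑ r^(t+1)`.
  obtain ⟨z, hz, hne⟩ := exists_sum_stdAddChar_pow_ne (N := g.m 0) (Nat.one_le_iff_ne_zero.2 h0) h1
    (a + g.m 0 * (∑ t ∈ Finset.range b, w ^ t) / w ^ b)
  let v : G g := Function.update (fun _ => 1) 0 z
  have hv0 : v 0 = z := Function.update_self _ _ _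
  have hv1 : v 1 = 1 := Function.update_of_ne (by norm_num) _ _
  have hv0' : v 0 ≠ 0 := by rw [hv0]; exact hz
  have hr1 : rademacher g 1 v = w := by rw [rademacher_eq, hv1]
  set r : ℂ := ZMod.stdAddChar z with hr
  have hr0 : rademacher g 0 v = r := by rw [rademacher_eq, hv0]
  have hrne : r ≠ 1 := by
    rw [← hr0]; exact fun h => hv0' (rademacher_eq_one_iff.1 h)
  have hrm : r ^ g.m 0 = 1 := by rw [← hr0]; exact rademacher_pow_m g 0 v
  refine ⟨v, hv0', ?_, ?_⟩
  · rw [hv1]; exact one_ne_zero_zmod g 1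
  have hE0 : indexSum g 0 v = 0 := by simp [indexSum, M_zero]
  have hD0 : dirichlet g (M g 0) v = 1 := by simp [dirichlet, M_zero, psi_zero]
  have hE1 : indexSum g 1 v = ∑ t ∈ Finset.range (g.m 0), (t : ℂ) * r ^ t := by
    rw [indexSum_succ, hE0, hD0, hr0, M_zero]; simp
  have hWa : fejerSum g a v = ∑ t ∈ Finset.range a, ((a : ℂ) - t) * r ^ t := by
    have h := fejerSum_mul_add (g := g) (K := 0) (a := a) (n := 0) (by omega) (Nat.zero_le _) v
    rw [M_zero, mul_one, add_zero, ← M_zero g, hD0, hE0, hr0] at h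
    rw [h]
    have hz0 : fejerSum g 0 v = 0 := by simp [fejerSum]
    rw [hz0, mul_zero, add_zero, M_zero]
    exact Finset.sum_congr rfl fun t _ => by push_cast; ring
  have hW := fejerSum_mul_add (g := g) (K := 1) (a := b) (n := a) hb1
    (by rw [← hn1]; exact (Nat.mod_lt _ (M_pos g 1)).le) v
  rw [← hnab, dirichlet_M_eq_zero zero_lt_one hv0', hr1, hE1, hWa] at hW
  simp_rw [mul_zero, zero_sub, ← Finset.sum_mul] at hW
  intro hzero
  apply hne
  have e1 := sub_one_mul_sum_mul_pow_of_root hrm hrne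
  have e2 := sub_one_mul_sum_sub_mul_pow r a
  rw [hzero] at hW
  have e3 : w ^ b * (∑ t ∈ Finset.range a, r ^ (t + 1) - a)
      = g.m 0 * ∑ t ∈ Finset.range b, w ^ t := by
    linear_combination (-(r - 1)) * hW + (∑ t ∈ Finset.range b, w ^ t) * e1 - w ^ b * e2
  field_simp
  linear_combination e3

/-- Only finitely many `n < M g 2` occur, so pointwise nonvanishing gives a uniform constant. -/
theorem exists_const_fejerSum_ge (g : GenSeq) :
    ∃ c : ℝ, 0 < c ∧ ∀ n < M g 2, digit g n 0 ≠ 0 → digit g n 0 + 1 < g.m 0 →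
      ∃ v : G g, v 0 ≠ 0 ∧ v 1 ≠ 0 ∧ c ≤ ‖fejerSum g n v‖ := by
  have h : ∀ n ∈ Finset.range (M g 2), ∀ᶠ c : ℝ in 𝓝[>] 0,
      digit g n 0 ≠ 0 → digit g n 0 + 1 < g.m 0 →
      ∃ v : G g, v 0 ≠ 0 ∧ v 1 ≠ 0 ∧ c ≤ ‖fejerSum g n v‖ := by
    intro n hn
    by_cases hc : digit g n 0 ≠ 0 ∧ digit g n 0 + 1 < g.m 0
    · obtain ⟨v, hv0, hv1, hv⟩ := exists_fejerSum_ne_zero (Finset.mem_range.1 hn) hc.1 hc.2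
      filter_upwards [Ioc_mem_nhdsGT (norm_pos_iff.2 hv)] with c hcm _ _
      exact ⟨v, hv0, hv1, hcm.2⟩
    · exact Eventually.of_forall fun c h0 h1 => absurd ⟨h0, h1⟩ hc
  obtain ⟨c, hc, hc0⟩ := (((Finset.range (M g 2)).eventually_all.2 h).and
    self_mem_nhdsWithin).exists
  exact ⟨c, hc0, fun n hn => hc n (Finset.mem_range.2 hn)⟩

/-- For `⟨n⟩ ≥ 1` the two ones sit at `⟨n⟩ - 1` and `⟨n⟩`. For `⟨n⟩ = 0` the required bound is only
a constant, but the interval must have bounded depth; this is where `R` enters. -/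
theorem exists_interval_fejerSum_ge {L : ℕ} (hL : ∀ k, g.m k ≤ L) (R : ℕ) :
    ∃ c : ℝ, 0 < c ∧ ∀ n, 1 ≤ n → lo g (n + 1) ≤ R →
      ∃ (J : ℕ) (v : G g), J ≤ lo g n + (R + 2) ∧ ∀ x ∈ interval g J v,
        (∀ K, J ≤ K → dirichlet g (M g K) x = 0 ∧ indexSum g K x = 0) ∧
        c * (M g (lo g n) : ℝ) ^ 2 ≤ ‖fejerSum g n x‖ := by
  obtain ⟨c₀, hc₀, h₀⟩ := exists_const_fejerSum_ge g
  have hL0 : (0 : ℝ) < L := by exact_mod_cast (m_pos g 0).trans_le (hL 0)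
  have hvan : ∀ (s : ℕ) (x : G g), x ∈ interval g (s + 2) (twoOnes g s) → x s ≠ 0 ∧
      ∀ K, s + 2 ≤ K → dirichlet g (M g K) x = 0 ∧ indexSum g K x = 0 := by
    intro s x hx
    have hxs : x s ≠ 0 := by
      rw [hx s (by omega)]; simpa [twoOnes] using one_ne_zero_zmod g s
    have hxs1 : x (s + 1) ≠ 0 := by
      rw [hx (s + 1) (by omega)]; simpa [twoOnes] using one_ne_zero_zmod g (s + 1)
    exact ⟨hxs, fun K hK => ⟨dirichlet_M_eq_zero (by omega : s < K) hxs,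
      indexSum_eq_zero (Nat.lt_succ_self s) hxs hxs1 hK⟩⟩
  refine ⟨min (1 / (2 * (L : ℝ) ^ 3)) c₀, by positivity, fun n hn hR => ?_⟩
  rcases Nat.eq_zero_or_eq_succ_pred (lo g n) with hs | hs
  · have hM1 : (M g (lo g n) : ℝ) = 1 := by rw [hs, M_zero, Nat.cast_one]
    rw [hM1, one_pow, mul_one]
    -- If `m_0` does not divide `n + 1`, then `n_0 + 1 < m_0` and a residue modulo `M_2` decides.
    -- Otherwise the kernel of `n + 1` is used, with its ones at `⟨n + 1⟩ - 1` and `⟨n + 1⟩`.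
    rcases Nat.eq_zero_or_eq_succ_pred (lo g (n + 1)) with hu | hu
    · have hd0 : digit g n 0 ≠ 0 := hs ▸ digit_lo_ne_zero g hn
      have hd1 : digit g n 0 + 1 < g.m 0 := by
        have h1 : digit g (n + 1) 0 ≠ 0 := by
          have := digit_lo_ne_zero g (Nat.le_add_left 1 n); rwa [hu] at this
        have h2 := digit_lt g n 0
        by_contra hc
        apply h1
        have h3 : n % g.m 0 + 1 = g.m 0 := by
          simp only [digit, M_zero, Nat.div_one] at h2 hc; omega
        rw [digit, M_zero, Nat.div_one, ← Nat.mod_add_mod, h3, Nat.mod_self]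
      have e0 : digit g (n % M g 2) 0 = digit g n 0 := digit_mod g n (by norm_num)
      obtain ⟨v, hv0, hv1, hv⟩ := h₀ (n % M g 2) (Nat.mod_lt _ (M_pos g 2))
        (by rw [e0]; exact hd0) (by rw [e0]; exact hd1)
      refine ⟨2, v, by omega, fun x hx => ?_⟩
      have hx0 : x 0 ≠ 0 := by rw [hx 0 (by norm_num)]; exact hv0
      have hx1 : x 1 ≠ 0 := by rw [hx 1 (by norm_num)]; exact hv1
      have hD : ∀ K, 2 ≤ K → dirichlet g (M g K) x = 0 := fun K hK =>
        dirichlet_M_eq_zero (by omega : 0 < K) hx0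
      have hE : ∀ K, 2 ≤ K → indexSum g K x = 0 := fun K hK =>
        indexSum_eq_zero zero_lt_one hx0 hx1 hK
      refine ⟨fun K hK => ⟨hD K hK, hE K hK⟩, ?_⟩
      rw [norm_fejerSum_mod hD hE, fejerSum_congr (Nat.mod_lt n (M_pos g 2)).le hx]
      exact (min_le_right _ _).trans hv
    · set s := (lo g (n + 1)).pred
      refine ⟨s + 2, twoOnes g s, by omega, fun x hx => ?_⟩
      obtain ⟨hxs, hv⟩ := hvan s x hx
      refine ⟨hv, ?_⟩
      -- Here `n + 1` is divisible by `M_{s+1}` and `x s ≠ 0`, so passing from `n + 1` back to `n`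
      -- changes nothing.
      have hD : dirichlet g (n + 1) x = 0 := by
        rw [← norm_eq_zero, norm_dirichlet_mod (J := s + 1)
          (fun K hK => dirichlet_M_eq_zero (by omega : s < K) hxs), ← Nat.succ_eq_add_one s, ← hu,
          mod_M_lo]
        simp [dirichlet]
      rw [fejerSum_eq_sub_dirichlet, hD, sub_zero]
      refine ((min_le_left _ _).trans ?_).trans
        (norm_fejerSum_twoOnes_ge hL hu (Nat.le_add_left 1 n) hx)
      gcongr
      exact one_le_pow₀ (by exact_mod_cast M_pos g (s + 1))
  · set s := (lo g n).pred
    refine ⟨s + 2, twoOnes g s, by omega, fun x hx => ?_⟩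
    refine ⟨(hvan s x hx).2, ?_⟩
    refine le_trans ?_ (norm_fejerSum_twoOnes_ge hL hs hn hx)
    rw [hs]
    refine (mul_le_mul_of_nonneg_right (min_le_left _ _) (by positivity)).trans (le_of_eq ?_)
    rw [Nat.succ_eq_add_one]; ring

end

section

variable {g : GenSeq} {p : ℝ}

/-! ### Block martingales -/

/-- The coefficients that are constant on the blocks `M_N ≤ i < M_{N+1}`, with value `b N`. -/
noncomputable def blockCoeff (g : GenSeq) (b : ℕ → ℝ) (i : ℕ) : ℂ := if i = 0 then 0 else b (hi g i)

theorem blockCoeff_of_mem {b : ℕ → ℝ} {i N : ℕ} (h1 : M g N ≤ i) (h2 : i < M g (N + 1)) :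
    blockCoeff g b i = b N := by
  have := M_pos g N
  rw [blockCoeff, if_neg (by omega), hi_eq h1 h2]

theorem poly_blockCoeff (b : ℕ → ℝ) (n : ℕ) (x : G g) :
    poly g (blockCoeff g b) (M g n) x
      = ∑ N ∈ Finset.range n, (b N : ℂ) * (dirichlet g (M g (N + 1)) x - dirichlet g (M g N) x) := by
  induction n with
  | zero => simp [poly, M_zero, blockCoeff]
  | succ n ih =>
    have hle := M_mono g (Nat.le_succ n)
    rw [Finset.sum_range_succ, ← ih, poly, poly, dirichlet, dirichlet,
      ← Finset.sum_Ico_eq_sub _ hle, ← Finset.sum_range_add_sum_Ico _ hle, Finset.mul_sum]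
    congr 1
    refine Finset.sum_congr rfl fun i hi => ?_
    rw [Finset.mem_Ico] at hi
    rw [blockCoeff_of_mem hi.1 hi.2]

theorem measurable_dirichlet (g : GenSeq) (n : ℕ) : Measurable (dirichlet g n) := by
  unfold dirichlet
  exact Finset.measurable_sum _ fun i _ => measurable_psi g i

theorem powInt_dirichlet_M (hp : 0 < p) (N : ℕ) :
    powInt g p (dirichlet g (M g N)) = ENNReal.ofReal ((M g N : ℝ) ^ (p - 1)) := by
  have hM := M_cast_pos g N
  have h : ∀ x, ‖dirichlet g (M g N) x‖ₑ ^ p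
      = (interval g N 0).indicator (fun _ => ENNReal.ofReal ((M g N : ℝ) ^ p)) x := by
    intro x
    rw [enorm_rpow_eq hp, dirichlet_M]
    by_cases hx : x ∈ interval g N 0
    · rw [Set.indicator_of_mem hx, Set.indicator_of_mem hx, Complex.norm_natCast]
    · rw [Set.indicator_of_notMem hx, Set.indicator_of_notMem hx, norm_zero,
        Real.zero_rpow hp.ne', ENNReal.ofReal_zero]
  rw [powInt]
  simp_rw [h]
  rw [lintegral_indicator_const (measurableSet_interval g N 0), haar_interval,
    ← ENNReal.ofReal_natCast, ← ENNReal.ofReal_inv_of_pos hM, ← ENNReal.ofReal_mul (by positivity),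
    Real.rpow_sub hM, Real.rpow_one, div_eq_mul_inv]

/-- The block with index `N` is a multiple of `D_{M_{N+1}} - D_{M_N}`, whose `p`-integral is at most
`2 M_N^(p-1)`; the weight `M_N^(1/p-1)` normalizes this. Every `f n` is a partial sum of blocks, so
`p`-subadditivity bounds the maximal function as well. -/
theorem lintegral_maximal_blockCoeff_le (hp : 0 < p) (hp1 : p ≤ 1) (γ : ℕ → ℝ)
    (hγ : ∀ N, 0 ≤ γ N) :
    ∫⁻ x, maximal g (fun n => poly g (blockCoeff g fun N => γ N * (M g N : ℝ) ^ (1 / p - 1))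
      (M g n)) x ^ p ∂(haar g) ≤ 2 * ∑' N, ENNReal.ofReal (γ N ^ p) := by
  set b : ℕ → ℝ := fun N => γ N * (M g N : ℝ) ^ (1 / p - 1) with hb
  set T : ℕ → G g → ℂ := fun N x =>
    (b N : ℂ) * (dirichlet g (M g (N + 1)) x + (-1) * dirichlet g (M g N) x) with hT
  have hD : ∀ N, Measurable fun x : G g =>
      dirichlet g (M g (N + 1)) x + (-1) * dirichlet g (M g N) x := fun N =>
    (measurable_dirichlet g _).add ((measurable_dirichlet g _).const_mul _)
  have hTm : ∀ N, Measurable (T N) := fun N => (hD N).const_mul _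
  have hpt : ∀ x, maximal g (fun n => poly g (blockCoeff g b) (M g n)) x ^ p
      ≤ ∑' N, ‖T N x‖ₑ ^ p := by
    intro x
    rw [← ENNReal.le_rpow_inv_iff hp, maximal]
    refine iSup_le fun n => ?_
    rw [ENNReal.le_rpow_inv_iff hp]
    have : poly g (blockCoeff g b) (M g n) x = ∑ N ∈ Finset.range n, T N x := by
      rw [poly_blockCoeff]
      exact Finset.sum_congr rfl fun N _ => by rw [hT]; ring
    rw [this]
    exact (enorm_sum_rpow_le hp hp1 _ _).trans (ENNReal.sum_le_tsum _)
  refine (lintegral_mono hpt).trans ?_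
  rw [lintegral_tsum fun N => ((hTm N).enorm.pow_const p).aemeasurable, ← ENNReal.tsum_mul_left]
  refine ENNReal.tsum_le_tsum fun N => ?_
  change powInt g p (T N) ≤ _
  have hM := M_cast_pos g N
  have h1 : powInt g p (fun x => dirichlet g (M g (N + 1)) x + (-1) * dirichlet g (M g N) x)
      ≤ ENNReal.ofReal (2 * (M g N : ℝ) ^ (p - 1)) := by
    refine (powInt_add_le hp hp1 (measurable_dirichlet g _)).trans ?_
    rw [powInt_const_mul hp _ (measurable_dirichlet g _), powInt_dirichlet_M hp,
      powInt_dirichlet_M hp, norm_neg, norm_one, Real.one_rpow, ENNReal.ofReal_one, one_mul,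
      ← ENNReal.ofReal_add (by positivity) (by positivity), two_mul]
    refine ENNReal.ofReal_le_ofReal (add_le_add ?_ le_rfl)
    exact Real.rpow_le_rpow_of_nonpos hM (by exact_mod_cast M_mono g (Nat.le_succ N)) (by linarith)
  rw [hT, powInt_const_mul hp _ (hD N)]
  refine (mul_le_mul' le_rfl h1).trans (le_of_eq ?_)
  have h2 : (2 : ℝ≥0∞) = ENNReal.ofReal 2 := by norm_num
  have hγN := hγ N
  rw [h2, ← ENNReal.ofReal_mul (by positivity), ← ENNReal.ofReal_mul zero_le_two, Complex.norm_real,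
    Real.norm_of_nonneg (by positivity), Real.mul_rpow (hγ N) (by positivity),
    ← Real.rpow_mul hM.le]
  have h3 : (M g N : ℝ) ^ ((1 / p - 1) * p) * (M g N : ℝ) ^ (p - 1) = 1 := by
    rw [← Real.rpow_add hM]
    have : (1 / p - 1) * p + (p - 1) = 0 := by field_simp; ring
    rw [this, Real.rpow_zero]
  congr 1
  linear_combination 2 * γ N ^ p * h3

theorem memHardy_blockCoeff (hp : 0 < p) (hp1 : p ≤ 1) (γ : ℕ → ℝ) (hγ : ∀ N, 0 ≤ γ N)
    (hsum : ∑' N, ENNReal.ofReal (γ N ^ p) < ∞) :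
    MemHardy g p
      (fun n => poly g (blockCoeff g fun N => γ N * (M g N : ℝ) ^ (1 / p - 1)) (M g n)) := by
  refine ⟨martingale_poly g _, ?_⟩
  rw [hardyNorm]
  refine ENNReal.rpow_lt_top_of_nonneg (by positivity) (ne_of_lt ?_)
  exact (lintegral_maximal_blockCoeff_le hp hp1 γ hγ).trans_lt (ENNReal.mul_lt_top (by simp) hsum)

theorem norm_fejer_blockCoeff_ge {b : ℕ → ℝ} (hb : ∀ N, 0 ≤ b N) {n : ℕ} (hn : 1 ≤ n) {x : G g}
    (hD : dirichlet g (M g (hi g n)) x = 0) (hE : indexSum g (hi g n) x = 0) :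
    b (hi g n) / n * ‖fejerSum g n x‖
        - ∑ i ∈ Finset.range (M g (hi g n)), ‖blockCoeff g b i‖
      ≤ ‖fejer g (fun k => poly g (blockCoeff g b) (M g k)) n x‖ := by
  set N := hi g n with hN
  have hn0 : (0 : ℝ) < n := by exact_mod_cast hn
  have hle : M g N ≤ n := M_hi_le g hn
  have h1 : fejer g (fun k => poly g (blockCoeff g b) (M g k)) n x
      = ((b N / n : ℝ) : ℂ) * fejerSum g n x
        + ∑ i ∈ Finset.range (M g N), (((n : ℂ) - i) / n) * (blockCoeff g b i * psi g i x) := by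
    rw [fejer_eq_poly, coeff_poly, poly, fejerSum, ← Finset.sum_range_add_sum_Ico _ hle,
      ← Finset.sum_range_add_sum_Ico _ hle]
    -- This sum is `n D_{M_N} - indexSum g N`, so the top block can be completed to the full kernel
    -- sum at no cost.
    have h2 : ∑ i ∈ Finset.range (M g N), ((n : ℂ) - i) * psi g i x = 0 := by
      simp_rw [sub_mul, Finset.sum_sub_distrib, ← Finset.mul_sum]
      rw [dirichlet] at hD
      rw [indexSum] at hE
      rw [hD, hE]; simp
    rw [h2, zero_add, add_comm, Finset.mul_sum]
    congr 1
    · refine Finset.sum_congr rfl fun i hi => ?_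
      rw [Finset.mem_Ico] at hi
      rw [blockCoeff_of_mem hi.1 (hi.2.trans (lt_M_hi_succ g n))]
      push_cast; ring
    · exact Finset.sum_congr rfl fun i _ => by ring
  have h3 : ‖∑ i ∈ Finset.range (M g N), (((n : ℂ) - i) / n) * (blockCoeff g b i * psi g i x)‖
      ≤ ∑ i ∈ Finset.range (M g N), ‖blockCoeff g b i‖ := by
    refine norm_sum_le_of_le _ fun i hi => ?_
    have hin : i ≤ n := (Finset.mem_range.1 hi).le.trans hle
    rw [norm_mul, norm_mul, norm_psi, mul_one, ← Nat.cast_sub hin, norm_div, Complex.norm_natCast,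
      Complex.norm_natCast]
    refine mul_le_of_le_one_left (norm_nonneg _) ?_
    rw [div_le_one hn0]
    exact_mod_cast Nat.sub_le _ _
  have h4 : ‖((b N / n : ℝ) : ℂ) * fejerSum g n x‖ = b N / n * ‖fejerSum g n x‖ := by
    rw [norm_mul, Complex.norm_real, Real.norm_of_nonneg (div_nonneg (hb N) hn0.le)]
  rw [h1, ← h4]
  have h5 := norm_sub_le_norm_add (((b N / n : ℝ) : ℂ) * fejerSum g n x)
    (∑ i ∈ Finset.range (M g N), (((n : ℂ) - i) / n) * (blockCoeff g b i * psi g i x))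
  linarith

/-! ### Lacunary subsequences -/

/-- The threshold for step `j` may depend on the level `A j` reached before; unboundedness of `q`
suffices, and the chosen indices `K j` need not increase. -/
theorem exists_lacunary {q : ℕ → ℝ} (hq : ∀ X : ℝ, ∃ k, X < q k) (N : ℕ → ℕ) (X : ℕ → ℕ → ℝ) :
    ∃ K A : ℕ → ℕ, (∀ j, X j (A j) < q (K j)) ∧ ∀ j, A (j + 1) = N (K j) := by
  choose pick hpick using fun j a => hq (X j a)
  let A : ℕ → ℕ := fun j => Nat.rec 0 (fun j a => N (pick j a)) j
  exact ⟨fun j => pick j (A j), A, fun j => hpick j (A j), fun j => rfl⟩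

theorem exists_lt_of_limsup_eq_top {q : ℕ → ℝ}
    (h : limsup (fun k => ENNReal.ofReal (q k)) atTop = ⊤) (X : ℝ) : ∃ k, X < q k := by
  have h1 : ENNReal.ofReal X < limsup (fun k => ENNReal.ofReal (q k)) atTop := by
    rw [h]; exact ENNReal.ofReal_lt_top
  obtain ⟨k, hk⟩ := (frequently_lt_of_lt_limsup (by isBoundedDefault) h1).exists
  refine ⟨k, ?_⟩
  by_contra! hc
  exact absurd (ENNReal.ofReal_le_ofReal hc) (not_le.2 hk)

theorem lt_hi_of_lt_rate (hp : 0 < p) (hp2 : p < 1 / 2) {n A : ℕ}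
    (h : (M g A : ℝ) ^ (1 / p - 2) < rate g p n) : A < hi g n := by
  have he := two_lt_one_div hp hp2
  have h1 : rate g p n ≤ (M g (hi g n) : ℝ) ^ (1 / p - 2) := by
    refine div_le_self (by positivity) (Real.one_le_rpow ?_ he.le)
    exact_mod_cast M_pos g (lo g n)
  have h2 := (Real.rpow_lt_rpow_iff (Nat.cast_nonneg _) (Nat.cast_nonneg _) he).1 (h.trans_le h1)
  exact (M_strictMono g).lt_iff_lt.1 (by exact_mod_cast h2)

/-- `M` grows by a factor of at most `L` per step, so a large rate forces a wide gap between the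
lowest and the highest digit. -/
theorem lo_add_le_hi_of_lt_rate {L : ℕ} (hL : ∀ k, g.m k ≤ L) (hp : 0 < p) (hp2 : p < 1 / 2)
    {n d : ℕ} (h : ((L : ℝ) ^ d) ^ (1 / p - 2) < rate g p n) : lo g n + d ≤ hi g n := by
  have he := two_lt_one_div hp hp2
  by_contra! hc
  refine absurd h (not_lt.2 ?_)
  have h1 := M_cast_pos g (lo g n)
  rw [rate, div_le_iff₀ (by positivity), ← Real.mul_rpow (by positivity) h1.le]
  refine Real.rpow_le_rpow (by positivity) ?_ he.le
  exact_mod_cast (M_mono g hc.le).trans (M_add_le g hL (lo g n) d)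

/-! ### Weak-norm lower bounds and the counterexample -/

theorem le_weakNorm (hp : 0 < p) {F : G g → ℂ} {t : ℝ} (ht : 0 < t) {J : ℕ} {v : G g}
    (hF : ∀ x ∈ interval g J v, t < ‖F x‖) :
    ENNReal.ofReal (t * ((M g J : ℝ)⁻¹) ^ (1 / p)) ≤ weakNorm g p F := by
  have hM := M_cast_pos g J
  have h1 : interval g J v ⊆ {x | ((t.toNNReal : ℝ≥0) : ℝ≥0∞) < ‖F x‖ₑ} := by
    intro x hx
    change ENNReal.ofReal t < ‖F x‖ₑ
    rw [← ofReal_norm, ENNReal.ofReal_lt_ofReal_iff_of_nonneg ht.le]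
    exact hF x hx
  rw [weakNorm]
  refine le_trans ?_ (le_iSup₂ (f := fun (t : ℝ≥0) (_ : 0 < t) =>
    (t : ℝ≥0∞) * haar g {x | (t : ℝ≥0∞) < ‖F x‖ₑ} ^ (1 / p)) t.toNNReal (Real.toNNReal_pos.2 ht))
  rw [ENNReal.ofReal_mul ht.le]
  refine mul_le_mul' le_rfl ?_
  rw [← ENNReal.ofReal_rpow_of_nonneg (by positivity) (by positivity),
    ENNReal.ofReal_inv_of_pos hM, ENNReal.ofReal_natCast, ← haar_interval g J v]
  exact ENNReal.rpow_le_rpow (measure_mono h1) (by positivity)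

theorem weakNorm_fejer_ge {L : ℕ} (hL : ∀ k, g.m k ≤ L) (hp : 0 < p)
    {R : ℕ} {c : ℝ} (hc : 0 < c) {γ : ℕ → ℝ} (hγ : ∀ N, 0 ≤ γ N) {n : ℕ} (hn : 1 ≤ n)
    {J : ℕ} {v : G g} (hJ : J ≤ lo g n + (R + 2)) (hJN : J ≤ hi g n)
    (hv : ∀ x ∈ interval g J v,
      (∀ K, J ≤ K → dirichlet g (M g K) x = 0 ∧ indexSum g K x = 0) ∧
      c * (M g (lo g n) : ℝ) ^ 2 ≤ ‖fejerSum g n x‖)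
    {a B q : ℝ} (ha : 0 < a) (hq : 0 < q) (hqa : q = rate g p n / a)
    (hγq : γ (hi g n) = q ^ (-(1 / 2) : ℝ))
    (hB : ∑ i ∈ Finset.range (M g (hi g n)),
      ‖blockCoeff g (fun N => γ N * (M g N : ℝ) ^ (1 / p - 1)) i‖ ≤ B)
    (hBq : B / a ≤ c / (2 * L) * q ^ (1 / 2 : ℝ)) :
    ENNReal.ofReal (c / (4 * L) * (((L : ℝ) ^ (R + 2))⁻¹) ^ (1 / p) * q ^ (1 / 2 : ℝ))
      ≤ weakNorm g p fun x => fejer g (fun k => poly g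
        (blockCoeff g fun N => γ N * (M g N : ℝ) ^ (1 / p - 1)) (M g k)) n x / (a : ℂ) := by
  set b : ℕ → ℝ := fun N => γ N * (M g N : ℝ) ^ (1 / p - 1) with hb
  set N := hi g n with hN
  set s := lo g n with hs
  have hb0 : ∀ N, 0 ≤ b N := fun N => mul_nonneg (hγ N) (by positivity)
  have hL0 : (0 : ℝ) < L := by exact_mod_cast (m_pos g 0).trans_le (hL 0)
  have hMs := M_cast_pos g s
  have hMN := M_cast_pos g N
  have hMJ := M_cast_pos g J
  have hn0 : (0 : ℝ) < n := by exact_mod_cast hn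
  set y := q ^ (1 / 2 : ℝ) with hy
  have hy0 : 0 < y := by positivity
  have hS1 : 1 ≤ (M g s : ℝ) ^ (1 / p) :=
    Real.one_le_rpow (by exact_mod_cast M_pos g s) (by positivity)
  -- The test level is a quarter of the lower bound for the main term; the lower blocks take at most
  -- half of that bound, which leaves a strict inequality.
  have ht : 0 < c / (4 * L) * y * (M g s : ℝ) ^ (1 / p) := by positivity
  have hyy : q ^ (-(1 / 2) : ℝ) * q = y := by
    rw [hy]; nth_rewrite 2 [← Real.rpow_one q]
    rw [← Real.rpow_add hq]; norm_num
  have hmain : ∀ x ∈ interval g J v, c / (4 * L) * y * (M g s : ℝ) ^ (1 / p)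
      < ‖fejer g (fun k => poly g (blockCoeff g b) (M g k)) n x / (a : ℂ)‖ := by
    intro x hx
    obtain ⟨hvan, hlow⟩ := hv x hx
    have h1 := norm_fejer_blockCoeff_ge hb0 hn (hvan N hJN).1 (hvan N hJN).2
    rw [norm_div, Complex.norm_real, Real.norm_of_nonneg ha.le, lt_div_iff₀ ha]
    have hnL : (n : ℝ) ≤ L * M g N := by
      have : (n : ℝ) ≤ M g (N + 1) := by exact_mod_cast (lt_M_hi_succ g n).le
      exact this.trans (M_succ_cast_le hL N)
    -- Uses `n ≤ L M_N`, `M_N^(1/p-2) = q a M_s^(1/p-2)` and `q^(-1/2) q = q^(1/2)`.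
    have h2 : c / L * y * (M g s : ℝ) ^ (1 / p) * a ≤ b N / n * ‖fejerSum g n x‖ := by
      calc c / L * y * (M g s : ℝ) ^ (1 / p) * a
          = b N / (L * M g N) * (c * (M g s : ℝ) ^ 2) := by
            have e1 : rate g p n = q * a := by rw [hqa]; field_simp
            have e2 : (M g N : ℝ) ^ (1 / p - 1) = (M g N : ℝ) ^ (1 / p - 2) * M g N := by
              nth_rewrite 3 [← Real.rpow_one (M g N : ℝ)]
              rw [← Real.rpow_add hMN]; congr 1; ring
            have e3 : (M g s : ℝ) ^ (1 / p) = (M g s : ℝ) ^ (1 / p - 2) * (M g s : ℝ) ^ 2 := by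
              rw [← Real.rpow_natCast (M g s : ℝ) 2, ← Real.rpow_add hMs]; congr 1; push_cast; ring
            have e4 : (M g N : ℝ) ^ (1 / p - 2) = q * a * (M g s : ℝ) ^ (1 / p - 2) := by
              rw [← e1, rate, div_mul_cancel₀ _ (by positivity)]
            simp only [hb]
            rw [hγq, e2, e3, e4, ← hyy]
            field_simp
        _ ≤ _ := by
          have := hb0 N
          gcongr
    have h3 : B ≤ c / (2 * L) * y * a := by rwa [div_le_iff₀ ha] at hBq
    have h4 : c / (2 * L) * y * a ≤ c / (2 * L) * y * (M g s : ℝ) ^ (1 / p) * a := by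
      have : 0 < c / (2 * L) * y := by positivity
      exact mul_le_mul_of_nonneg_right (le_mul_of_one_le_right this.le hS1) ha.le
    have h5 : c / L * y * (M g s : ℝ) ^ (1 / p) * a
        = 4 * (c / (4 * L) * y * (M g s : ℝ) ^ (1 / p) * a) := by field_simp
    have h6 : c / (2 * L) * y * (M g s : ℝ) ^ (1 / p) * a
        = 2 * (c / (4 * L) * y * (M g s : ℝ) ^ (1 / p) * a) := by field_simp; norm_num
    have h7 : 0 < c / (4 * L) * y * (M g s : ℝ) ^ (1 / p) * a := by positivity
    linarith
  refine le_trans (ENNReal.ofReal_le_ofReal ?_) (le_weakNorm hp ht hmain)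
  have h8 : (M g J : ℝ) ≤ (L : ℝ) ^ (R + 2) * M g s := by
    exact_mod_cast (M_mono g hJ).trans (M_add_le g hL s (R + 2))
  calc c / (4 * L) * (((L : ℝ) ^ (R + 2))⁻¹) ^ (1 / p) * y
      = c / (4 * L) * y * (M g s : ℝ) ^ (1 / p)
        * (((L : ℝ) ^ (R + 2) * M g s)⁻¹) ^ (1 / p) := by
        rw [mul_inv, Real.mul_rpow (by positivity) (by positivity), Real.inv_rpow hMs.le]
        field_simp
    _ ≤ _ := by gcongr

theorem exists_memHardy_weakNorm_eq_top (hm : BddAbove (Set.range g.m)) (hp : 0 < p)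
    (hp2 : p < 1 / 2) {n : ℕ → ℕ} {Φ : ℕ → ℝ} (hn : ∀ k, 1 ≤ n k) (hΦ : Monotone Φ)
    (hΦ0 : ∀ j, 0 < Φ j) (hR : BddAbove (Set.range fun k => lo g (n k + 1)))
    (hlim : limsup (fun k => ENNReal.ofReal (rate g p (n k) / Φ (n k))) atTop = ⊤) :
    ∃ f : ℕ → G g → ℂ, MemHardy g p f ∧
      (⨆ k, weakNorm g p fun x => fejer g f (n k) x / (Φ (n k) : ℂ)) = ⊤ := by
  obtain ⟨L, hL'⟩ := hm
  have hL : ∀ k, g.m k ≤ L := fun k => hL' ⟨k, rfl⟩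
  obtain ⟨R, hR'⟩ := hR
  have hR : ∀ k, lo g (n k + 1) ≤ R := fun k => hR' ⟨k, rfl⟩
  obtain ⟨c, hc, hker⟩ := exists_interval_fejerSum_ge hL R
  have hL0 : (0 : ℝ) < L := by exact_mod_cast (m_pos g 0).trans_le (hL 0)
  set q : ℕ → ℝ := fun k => rate g p (n k) / Φ (n k) with hq
  have hq0 : ∀ k, 0 < q k := fun k => div_pos (rate_pos g p _) (hΦ0 _)
  have hqrate : ∀ k, q k * Φ 0 ≤ rate g p (n k) := fun k => by
    have h1 : q k * Φ (n k) = rate g p (n k) := div_mul_cancel₀ _ (hΦ0 _).ne'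
    rw [← h1]
    exact mul_le_mul_of_nonneg_left (hΦ (Nat.zero_le _)) (hq0 k).le
  -- Bounds the coefficients of all blocks up to `A`, whatever `γ ≤ 1` is chosen later, so it can be
  -- used in the threshold before `γ` exists.
  set B : ℕ → ℝ := fun A => ∑ i ∈ Finset.range (M g (A + 1)), (M g (hi g i) : ℝ) ^ (1 / p - 1)
    with hBdef
  -- The thresholds serve, in order: `A` increases; the exceptional interval has depth at most
  -- `|n|`; `γ^p ≤ 2^(-j)` is summable; `q^(1/2) ≥ j` is unbounded; `γ ≤ 1`; the earlier blocks are
  -- negligible. Division by `Φ 0` turns a lower bound for `q` into one for the rate, as `Φ` is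
  -- nondecreasing.
  obtain ⟨K, A, hX, hA⟩ := exists_lacunary (exists_lt_of_limsup_eq_top hlim)
    (fun k => hi g (n k)) (fun j A =>
      max (max ((M g A : ℝ) ^ (1 / p - 2) / Φ 0) (((L : ℝ) ^ (R + 2)) ^ (1 / p - 2) / Φ 0))
        (max (((2 : ℝ) ^ j) ^ (2 / p)) (max (max ((j : ℝ) ^ 2) 1)
          ((B A / Φ 0 * (2 * L / c)) ^ 2))))
  simp only [max_lt_iff] at hX
  have hΦ00 := hΦ0 0
  have hmono : StrictMono A := strictMono_nat_of_lt_succ fun j => by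
    rw [hA j]
    refine lt_hi_of_lt_rate hp hp2 (lt_of_lt_of_le ?_ (hqrate (K j)))
    exact (div_lt_iff₀ hΦ00).1 (hX j).1.1
  set N : ℕ → ℕ := fun j => A (j + 1) with hN
  have hNinj : Function.Injective N := fun i j hij => by
    have := hmono.injective hij; omega
  set γ : ℕ → ℝ := Function.extend N (fun j => q (K j) ^ (-(1 / 2) : ℝ)) 0 with hγdef
  have hγN : ∀ j, γ (N j) = q (K j) ^ (-(1 / 2) : ℝ) := fun j => hNinj.extend_apply _ _ j
  have hγ' : ∀ i, (¬ ∃ j, N j = i) → γ i = 0 := fun i hi => Function.extend_apply' _ _ i hi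
  have hγ : ∀ i, 0 ≤ γ i ∧ γ i ≤ 1 := by
    intro i
    by_cases hi : ∃ j, N j = i
    · obtain ⟨j, rfl⟩ := hi
      have := hq0 (K j)
      rw [hγN]
      refine ⟨by positivity, ?_⟩
      exact Real.rpow_le_one_of_one_le_of_nonpos (hX j).2.2.1.2.le (by norm_num)
    · rw [hγ' i hi]; exact ⟨le_rfl, zero_le_one⟩
  have hsum : ∑' i, ENNReal.ofReal (γ i ^ p) < ∞ := by
    rw [← hNinj.tsum_eq]
    · refine lt_of_le_of_lt (ENNReal.tsum_le_tsum fun j => ?_)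
        (summable_geometric_two.tsum_ofReal_lt_top)
      refine ENNReal.ofReal_le_ofReal ?_
      have hqj := hq0 (K j)
      have h1 : (2 : ℝ) ^ j ≤ q (K j) ^ (p / 2) := by
        calc (2 : ℝ) ^ j = (((2 : ℝ) ^ j) ^ (2 / p)) ^ (p / 2) := by
              rw [← Real.rpow_mul (by positivity)]
              have : 2 / p * (p / 2) = 1 := by field_simp
              rw [this, Real.rpow_one]
          _ ≤ _ := Real.rpow_le_rpow (by positivity) (hX j).2.1.le (by positivity)
      rw [hγN, ← Real.rpow_mul hqj.le, show -(1 / 2) * p = -(p / 2) by ring, Real.rpow_neg hqj.le,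
        one_div, inv_pow]
      exact inv_anti₀ (by positivity) h1
    · intro i hi
      by_contra hc
      apply hi
      simp only [hγ' i hc, Real.zero_rpow hp.ne', ENNReal.ofReal_zero]
  refine ⟨_, memHardy_blockCoeff hp (by linarith) γ (fun i => (hγ i).1) hsum, ?_⟩
  set D : ℝ := c / (4 * L) * (((L : ℝ) ^ (R + 2))⁻¹) ^ (1 / p) with hD
  have hD0 : 0 < D := by positivity
  refine ENNReal.eq_top_of_forall_nnreal_le fun r => ?_
  obtain ⟨j, hj⟩ := exists_nat_ge ((r : ℝ) / D)
  refine le_trans ?_ (le_iSup _ (K j))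
  have hqj := hq0 (K j)
  have hroot : ∀ {u : ℝ}, u ^ 2 < q (K j) → u ≤ q (K j) ^ (1 / 2 : ℝ) := fun {u} hu => by
    rw [← Real.sqrt_eq_rpow]; exact Real.le_sqrt_of_sq_le hu.le
  have hB : ∑ i ∈ Finset.range (M g (hi g (n (K j)))),
      ‖blockCoeff g (fun N => γ N * (M g N : ℝ) ^ (1 / p - 1)) i‖ ≤ B (A j) := by
    have hle : M g (A j + 1) ≤ M g (hi g (n (K j))) := by
      rw [← hA j]; exact M_mono g (hmono (Nat.lt_succ_self j))
    rw [hBdef, ← Finset.sum_range_add_sum_Ico _ hle, Finset.sum_eq_zero (s := Finset.Ico _ _),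
      add_zero]
    · refine Finset.sum_le_sum fun i _ => ?_
      rw [blockCoeff]
      split_ifs
      · rw [norm_zero]; positivity
      · have := (hγ (hi g i)).1
        rw [Complex.norm_real, Real.norm_of_nonneg (by positivity)]
        exact mul_le_of_le_one_left (by positivity) (hγ (hi g i)).2
    · intro i hmem
      rw [Finset.mem_Ico, ← hA j] at hmem
      have h1 : A j < hi g i := by
        have := (M_strictMono g).lt_iff_lt.1 (hmem.1.trans_lt (lt_M_hi_succ g i)); omega
      have h2 : hi g i < A (j + 1) := (M_strictMono g).lt_iff_lt.1
        ((M_hi_le g ((M_pos g _).trans_le hmem.1)).trans_lt hmem.2)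
      -- No selected level lies strictly between `A j` and `A (j + 1)`, so these blocks carry the
      -- default value zero.
      have h3 : γ (hi g i) = 0 := by
        refine hγ' _ ?_
        rintro ⟨j', hj'⟩
        rw [← hj'] at h1 h2
        have h4 := hmono.lt_iff_lt.1 h1
        have h5 := hmono.lt_iff_lt.1 h2
        omega
      rw [blockCoeff, h3, zero_mul]; simp
  have hBq : B (A j) / Φ (n (K j)) ≤ c / (2 * L) * q (K j) ^ (1 / 2 : ℝ) := by
    have h1 := hroot (hX j).2.2.2
    have hB0 : 0 ≤ B (A j) := Finset.sum_nonneg fun i _ => by positivity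
    have h2 : B (A j) / Φ (n (K j)) ≤ B (A j) / Φ 0 := by
      gcongr
      exact hΦ (Nat.zero_le _)
    refine h2.trans ?_
    calc B (A j) / Φ 0 = c / (2 * L) * (B (A j) / Φ 0 * (2 * L / c)) := by field_simp
      _ ≤ _ := by gcongr
  obtain ⟨J, v, hJ, hv⟩ := hker (n (K j)) (hn _) (hR _)
  have hJN : J ≤ hi g (n (K j)) := hJ.trans (lo_add_le_hi_of_lt_rate hL hp hp2
    (lt_of_lt_of_le ((div_lt_iff₀ hΦ00).1 (hX j).1.2) (hqrate (K j))))
  refine le_trans ?_ (weakNorm_fejer_ge hL hp hc (fun i => (hγ i).1) (hn (K j)) hJ hJN hv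
    (hΦ0 (n (K j))) hqj rfl (by rw [← hA j]; exact hγN j) hB hBq)
  rw [← hD, ← ENNReal.ofReal_coe_nnreal]
  refine ENNReal.ofReal_le_ofReal ?_
  rw [div_le_iff₀ hD0] at hj
  calc (r : ℝ) ≤ j * D := hj
    _ = D * j := mul_comm _ _
    _ ≤ _ := by
      gcongr
      exact hroot (hX j).2.2.1.1

end

end Vilenkin

theorem mainTheorem1 :
    (∀ (L : ℕ) (p : ℝ), 0 < p → p < 1 / 2 →
      ∃ c : ℝ, 0 < c ∧ ∀ g : Vilenkin.GenSeq, (∀ k, g.m k ≤ L) →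
        ∀ f : ℕ → Vilenkin.G g → ℂ, Vilenkin.MemHardy g p f →
          ∀ n : ℕ, 1 ≤ n →
            Vilenkin.hardyNorm g p (Vilenkin.regular g (Vilenkin.fejer g f n)) ≤
              ENNReal.ofReal (c * Vilenkin.rate g p n) * Vilenkin.hardyNorm g p f) ∧
    (∀ (g : Vilenkin.GenSeq) (p : ℝ), BddAbove (Set.range g.m) → 0 < p → p < 1 / 2 →
      ∀ (n : ℕ → ℕ) (Φ : ℕ → ℝ), (∀ k, 1 ≤ n k) → Monotone Φ → (∀ j, 0 < Φ j) →
        BddAbove (Set.range fun k => Vilenkin.lo g (n k + 1)) →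
        (⨆ k, (Vilenkin.rho g (n k) : ℕ∞)) = ⊤ →
        Filter.limsup (fun k => ENNReal.ofReal (Vilenkin.rate g p (n k) / Φ (n k)))
          Filter.atTop = ⊤ →
        ∃ f : ℕ → Vilenkin.G g → ℂ, Vilenkin.MemHardy g p f ∧
          (⨆ k, Vilenkin.weakNorm g p
            fun x => Vilenkin.fejer g f (n k) x / (Φ (n k) : ℂ)) = ⊤) := by
  refine ⟨fun L p hp hp2 => ⟨Vilenkin.fejerConst L p ^ (1 / p),
    Real.rpow_pos_of_pos (Vilenkin.fejerConst_pos L hp hp2) _, fun g hL f hf n hn =>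
    Vilenkin.hardyNorm_fejer_le hL hp hp2 hf.1 hn⟩, ?_⟩
  intro g p hm hp hp2 n Φ hn hΦ hΦ0 hR _ hlim
  exact Vilenkin.exists_memHardy_weakNorm_eq_top hm hp hp2 hn hΦ hΦ0 hR hlim
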